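/- \textbf{Theorem (Generalized Optical Theorem).} Let $V\subset\mathbb R^3$ be a bounded open set, $k>0$ and $\chi\in\mathbb C$. Let $L^2(V;\mathbb C^3)$ carry the scalar product $\langle \mathbf F,\mathbf G\rangle_V=\int_V \mathbf F^*(\mathbf r)\cdot\mathbf G(\mathbf r)\,d^3\mathbf r$. For $\mathbf E\in L^2(V;\mathbb C^3)$ put $$(\hat{\mathcal C}\mathbf E)(\mathbf r)=\int_V\frac{\mathbf E(\mathbf r')e^{-ik|\mathbf r-\mathbf r'|}}{4\pi|\mathbf r-\mathbf r'|}\,d^3\mathbf r',\qquad \tilde{\mathbf E}(\mathbf q)=\int_V\mathbf E(\mathbf r)e^{i\mathbf q\cdot\mathbf r}\,d^3\mathbf r .$$ Then the formulas $$\hat{\mathcal G}\mathbf E=\nabla\times\nabla\times\hat{\mathcal C}\mathbf E-\mathbf E,\qquad \hat{\mathcal B}\mathbf E=(1+\chi)\mathbf E-\chi\nabla\times\nabla\times\hat{\mathcal C}\mathbf E\qquad\text{on }V,$$ with derivatives in the sense of distributions on $V$ (and $\nabla\times\nabla\times\hat{\mathcal C}\mathbf E\in L^2(V;\mathbb C^3)$),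 define unique bounded linear operators on $L^2(V;\mathbb C^3)$; one has $\hat{\mathcal B}=\hat I-\chi\hat{\mathcal G}$; and for every $\mathbf E\in L^2(V;\mathbb C^3)$, with $d\Omega$ the surface measure of the unit sphere, $$\frac{|\chi|^2k^5}{16\pi^2}\oint_{|\mathbf n|=1}|\mathbf n\times\tilde{\mathbf E}(k\mathbf n)|^2\,d\Omega=\operatorname{Im}\Big[\chi k^2\int_V|\mathbf E|^2\,d^3\mathbf r\Big]-\operatorname{Im}\Big[\chi k^2\int_V(\hat{\mathcal B}\mathbf E)^*\cdot\mathbf E\,d^3\mathbf r\Big]=\operatorname{Im}\langle\mathbf E-\hat{\mathcal B}\mathbf E,\chi k^2\mathbf E\rangle_V .$$ Hence, with $\sigma_{\mathrm{sc}}=\frac{|\chi|^2k^4}{16\pi^2}\oint_{|\mathbf n|=1}|\mathbf n\times\tilde{\mathbf E}(k\mathbf n)|^2\,d\Omega$, $\sigma_{\mathrm{abs}}=\operatorname{Im}\big[-\chi k\int_V|\mathbf E|^2\,d^3\mathbf r\big]$ and incident field $\mathbf E_{\mathrm{inc}}=\hat{\mathcal B}\mathbf E$, the energy balance $$\sigma_{\mathrm{sc}}+\sigma_{\mathrm{abs}}=\frac{4\pi}{k}\operatorname{Im}\Big[-\frac{\chi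 k^2}{4\pi}\int_V\mathbf E_{\mathrm{inc}}^*\cdot\mathbf E\,d^3\mathbf r\Big]$$ holds. Moreover, $$\operatorname{Im}\langle\hat{\mathcal G}\mathbf E,\mathbf E\rangle_V=\frac{k^3}{16\pi^2}\oint_{|\mathbf n|=1}|\mathbf n\times\tilde{\mathbf E}(k\mathbf n)|^2\,d\Omega .$$ -/

import Mathlib

open MeasureTheory
open scoped ContDiff

noncomputable section

namespace BornScattering

/-- Physical space `ℝ³` with its Euclidean norm. -/
abbrev R3 : Type := EuclideanSpace ℝ (Fin 3)

/-- The space `ℂ³` of field values with its Hermitian norm. -/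
abbrev C3 : Type := EuclideanSpace ℂ (Fin 3)

/-- The Hilbert space `L²(V; ℂ³)`. Its inner product `inner ℂ F G` is `∫_V F* · G`
(conjugate-linear in the first argument). -/
abbrev L2 (V : Set R3) : Type := Lp C3 2 (volume.restrict V)

/-- The bilinear dot product of `ℂ³`, without complex conjugation. -/
def dot (a b : C3) : ℂ := ∑ i, a i * b i

/-- The cross product `n × v` of a real vector `n` with a complex vector `v`. -/
def cross (n : R3) (v : C3) : C3 :=
  WithLp.toLp 2 (crossProduct (fun i => (n i : ℂ)) v.ofLp)

/-- The classical partial derivative `∂F_j / ∂x_i` at the point `r`. -/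
def partialDeriv (i j : Fin 3) (F : R3 → C3) (r : R3) : ℂ :=
  fderiv ℝ F r (EuclideanSpace.single i 1) j

/-- The classical curl `∇ × F`. -/
def curl (F : R3 → C3) (r : R3) : C3 :=
  !₂[partialDeriv 1 2 F r - partialDeriv 2 1 F r,
     partialDeriv 2 0 F r - partialDeriv 0 2 F r,
     partialDeriv 0 1 F r - partialDeriv 1 0 F r]

/-- Test fields: smooth fields with compact support contained in `V`. -/
def IsTestField (V : Set R3) (φ : R3 → C3) : Prop :=
  ContDiff ℝ ∞ φ ∧ HasCompactSupport φ ∧ tsupport φ ⊆ V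

/-- `∇ × ∇ × A = W` in the sense of distributions on `V`. The curl is formally symmetric for
the bilinear dot product, so both derivatives fall on the test field without a sign. -/
def HasWeakCurlCurl (V : Set R3) (A W : R3 → C3) : Prop :=
  ∀ φ : R3 → C3, IsTestField V φ →
    ∫ r in V, dot (W r) (φ r) = ∫ r in V, dot (A r) (curl (curl φ) r)

/-- The outgoing Helmholtz kernel `e^{-ik|r - r'|} / (4π |r - r'|)`
(time dependence `e^{iωt}`). -/
def helmholtzKernel (k : ℝ) (r r' : R3) : ℂ :=
  Complex.exp (-(Complex.I * k * ‖r - r'‖)) / (4 * Real.pi * ‖r - r'‖)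

/-- The retarded volume potential
`r ↦ ∫_V E(r') e^{-ik|r - r'|} / (4π |r - r'|) d³r'`, defined on all of `ℝ³`. -/
def potential (k : ℝ) (V : Set R3) (E : R3 → C3) (r : R3) : C3 :=
  ∫ r' in V, helmholtzKernel k r r' • E r'

/-- `B` is the Born operator on `L²(V; ℂ³)`:
`B E = (1 + χ) E - χ ∇ × ∇ × ∫_V E(r') e^{-ik|r - r'|} / (4π |r - r'|) d³r'` on `V`,
with distributional derivatives. -/
def IsBornOperator (k : ℝ) (χ : ℂ) (V : Set R3) (B : L2 V →L[ℂ] L2 V) : Prop :=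
  ∀ E : L2 V, ∃ W : L2 V, HasWeakCurlCurl V (potential k V E) W ∧ B E = (1 + χ) • E - χ • W

/-- `G` is the Green operator on `L²(V; ℂ³)`:
`G E = ∇ × ∇ × ∫_V E(r') e^{-ik|r - r'|} / (4π |r - r'|) d³r' - E` on `V`,
with distributional derivatives. -/
def IsGreenOperator (k : ℝ) (V : Set R3) (G : L2 V →L[ℂ] L2 V) : Prop :=
  ∀ E : L2 V, ∃ W : L2 V, HasWeakCurlCurl V (potential k V E) W ∧ G E = W - E

/-- The Fourier transform `Ẽ(q) = ∫_V E(r) e^{iq·r} d³r` of a field living on `V`. -/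
def fourier (V : Set R3) (E : R3 → C3) (q : R3) : C3 :=
  ∫ r in V, Complex.exp (Complex.I * (inner ℝ q r : ℝ)) • E r

/-- `∮_{|n| = 1} |n × Ẽ(kn)|² dΩ`, with respect to the surface measure of the unit sphere. -/
def sphereIntegral (k : ℝ) (V : Set R3) (E : R3 → C3) : ℝ :=
  ∫ n : Metric.sphere (0 : R3) 1,
    ‖cross (n : R3) (fourier V E (k • (n : R3)))‖ ^ 2 ∂(volume : Measure R3).toSphere

/-- The total scattering cross-section
`σ_sc = (|χ|² k⁴ / 16π²) ∮_{|n| = 1} |n × Ẽ(kn)|² dΩ`. -/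
def scatteringCrossSection (k : ℝ) (χ : ℂ) (V : Set R3) (E : R3 → C3) : ℝ :=
  ‖χ‖ ^ 2 * k ^ 4 / (16 * Real.pi ^ 2) * sphereIntegral k V E

/-- The total absorption cross-section `σ_abs = Im [-χ k ∫_V |E|²]`. -/
def absorptionCrossSection (k : ℝ) (χ : ℂ) (V : Set R3) (E : R3 → C3) : ℝ :=
  (-χ * k * ((∫ r in V, ‖E r‖ ^ 2 : ℝ) : ℂ)).im

end BornScattering

end

open BornScattering

namespace BornScattering
open Set Metric ComplexConjugate FourierTransform Convolution

/-! ### The plane wave average over the unit sphere -/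

/-! Existence. For points of the bounded set `V` the differences lie in a ball of radius `D`, so on
`V` the potential is a convolution with the kernel cut off at `D`, which is integrable. In polar
coordinates its Fourier transform at `q` is `|q|⁻¹ ∫₀^D e^{-iks} sin(|q|s) ds`, and one integration
by parts bounds it by `(2 + |k| D) / |q|²`. The double curl has the symbol `-q × (q × ·)`, of norm
at most `|q|²`. The product of the two is bounded, so by Plancherel the double curl of the potential
is bounded in `L²` on test fields (`norm_integral_dot_convolution_le`). It extends by density to an
operator `T` (`curlCurlOp`), and the weak equation passes to the limit
(`hasWeakCurlCurl_curlCurlOp`). Density also makes a weak double curl in `L²` unique, so necessarily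
`G = T - 1` and `B = (1 + χ) - χ T`.

Optical identity. The singularity cancels in `conj κ - κ = 2i sin(k|x|) / (4π|x|)`, and `sin(k|x|) /
(k|x|)` is the average of the plane waves `e^{ikn·x}` over unit vectors `n` (`integral_sphere_exp`,
`conj_differenceKernel_sub`). Since the form of `T` is symmetric for the bilinear pairing, `Im ⟨T E,
E⟩` only sees `conj κ - κ`. It therefore splits into far fields on the sphere `|q| = k`, where the
symbol of the double curl turns `⟨Ẽ, ·⟩` into `k² |n × Ẽ|²` (`im_inner_curlCurlPotential`). Both
sides are continuous in `E`, so test fields suffice. The remaining identities are algebra based on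
`E - B E = χ G E` and on `⟨E, E⟩` being real. -/

theorem integral_eq_integral_sphere {f : R3 → ℂ} (hf : Integrable f) :
    ∫ x, f x = ∫ s in Ioi (0 : ℝ), ((s ^ 2 : ℝ) : ℂ) *
      ∫ n : sphere (0 : R3) 1, f (s • (n : R3)) ∂(volume : Measure R3).toSphere := by
  have hd : Module.finrank ℝ R3 - 1 = 2 := by simp
  have mp := (volume : Measure R3).measurePreserving_homeomorphUnitSphereProd
  have me := (homeomorphUnitSphereProd R3).measurableEmbedding
  rw [hd] at mp
  -- The polar homeomorphism lives on the complement of the origin, which has full measure.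
  have h1 : ∫ x, f x = ∫ x : ({0}ᶜ : Set R3), f x ∂((volume : Measure R3).comap (↑)) := by
    rw [integral_subtype_comap (measurableSet_singleton _).compl, restrict_compl_singleton]
  have hfi : Integrable (fun p : sphere (0 : R3) 1 × Ioi (0 : ℝ) => f ((p.2 : ℝ) • (p.1 : R3)))
      ((volume : Measure R3).toSphere.prod (Measure.volumeIoiPow 2)) := by
    rw [← mp.integrable_comp_emb me]
    have : Integrable (fun x : ({0}ᶜ : Set R3) => f x) ((volume : Measure R3).comap (↑)) := by
      exact (integrableOn_iff_comap_subtypeVal (measurableSet_singleton _).compl).1 hf.integrableOn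
    refine this.congr (Filter.Eventually.of_forall fun x => ?_)
    have hx : ‖(x : R3)‖ ≠ 0 := norm_ne_zero_iff.2 x.2
    simp [smul_smul, hx]
  have h2 : ∫ x : ({0}ᶜ : Set R3), f x ∂((volume : Measure R3).comap (↑)) =
      ∫ p : sphere (0 : R3) 1 × Ioi (0 : ℝ), f ((p.2 : ℝ) • (p.1 : R3))
        ∂((volume : Measure R3).toSphere.prod (Measure.volumeIoiPow 2)) := by
    rw [← mp.integral_comp me]
    refine integral_congr_ae (Filter.Eventually.of_forall fun x => ?_)
    have hx : ‖(x : R3)‖ ≠ 0 := norm_ne_zero_iff.2 x.2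
    simp [smul_smul, hx]
  rw [h1, h2, integral_prod_symm _ hfi, Measure.volumeIoiPow,
    integral_withDensity_eq_integral_toReal_smul (by fun_prop) (by simp),
    integral_subtype_comap measurableSet_Ioi
      (fun s : ℝ => (ENNReal.ofReal (s ^ 2)).toReal • ∫ n : sphere (0 : R3) 1, f (s • (n : R3)) ∂(volume : Measure R3).toSphere)]
  refine setIntegral_congr_fun measurableSet_Ioi fun s hs => ?_
  simp [ENNReal.toReal_ofReal (sq_nonneg s)]

/-- These discs are the slices of a ball in `ℝ³`. Negative `c` is allowed because `ENNReal.ofReal`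
then vanishes, as does the measure of the empty slice. -/
theorem volume_disc (c : ℝ) :
    volume {y : Fin 2 → ℝ | y 0 ^ 2 + y 1 ^ 2 < c} = ENNReal.ofReal (Real.pi * c) := by
  have hS : {y : Fin 2 → ℝ | y 0 ^ 2 + y 1 ^ 2 < c} =
      WithLp.toLp 2 ⁻¹' ball (0 : EuclideanSpace ℝ (Fin 2)) (√c) := by
    ext y
    simp [EuclideanSpace.norm_eq, Fin.sum_univ_two, Real.sqrt_lt_sqrt_iff (add_nonneg (sq_nonneg (y 0)) (sq_nonneg (y 1)))]
  rw [hS, (PiLp.volume_preserving_toLp (Fin 2)).measure_preimage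
    measurableSet_ball.nullMeasurableSet, EuclideanSpace.volume_ball_fin_two,
    ← ENNReal.ofReal_pow (Real.sqrt_nonneg c)]
  rcases le_total 0 c with hc | hc
  · rw [Real.sq_sqrt hc, ← ENNReal.ofReal_mul hc, mul_comm]
  · rw [Real.sqrt_eq_zero_of_nonpos hc, ENNReal.ofReal_of_nonpos (p := Real.pi * c)]
    · simp
    · exact mul_nonpos_of_nonneg_of_nonpos Real.pi_pos.le hc

/-- Slicing by the planes `x 0 = z` gives discs of area `π (R² - z²)`, which leaves an elementary
integral in `z`. -/
theorem integral_ball_exp (R : ℝ) (hR : 0 ≤ R) :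
    ∫ x in ball (0 : R3) R, Complex.exp (Complex.I * (x 0 : ℝ)) =
      ((4 * Real.pi * (Real.sin R - R * Real.cos R) : ℝ) : ℂ) := by
  have h1 : ∫ x in ball (0 : R3) R, Complex.exp (Complex.I * (x 0 : ℝ)) =
      ∫ z : ℝ, ∫ y : Fin 2 → ℝ, ({y : Fin 2 → ℝ | y 0 ^ 2 + y 1 ^ 2 < R ^ 2 - z ^ 2}).indicator
        (fun _ => Complex.exp (Complex.I * z)) y := by
    have e := (volume_preserving_piFinSuccAbove (fun _ : Fin 3 => ℝ) 0).symm
    have me := (MeasurableEquiv.piFinSuccAbove (fun _ : Fin 3 => ℝ) 0).symm.measurableEmbedding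
    have mt := PiLp.volume_preserving_toLp (Fin 3)
    have met := (MeasurableEquiv.toLp 2 (Fin 3 → ℝ)).measurableEmbedding
    have hint : Integrable ((ball (0 : R3) R).indicator
        fun x => Complex.exp (Complex.I * (x 0 : ℝ))) := by
      rw [integrable_indicator_iff measurableSet_ball]
      have hc : Continuous fun x : R3 => Complex.exp (Complex.I * (x 0 : ℝ)) := by fun_prop
      exact (hc.continuousOn.integrableOn_compact
        (isCompact_closedBall (0 : R3) R)).mono_set ball_subset_closedBall
    rw [← integral_indicator measurableSet_ball, ← mt.integral_comp met, ← e.integral_comp me,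
      Measure.volume_eq_prod, integral_prod]
    · refine integral_congr_ae (Filter.Eventually.of_forall fun z => ?_)
      refine integral_congr_ae (Filter.Eventually.of_forall fun y => ?_)
      have hm : WithLp.toLp 2 ((MeasurableEquiv.piFinSuccAbove (fun _ : Fin 3 => ℝ) 0).symm (z, y))
          ∈ ball (0 : R3) R ↔ y ∈ {y : Fin 2 → ℝ | y 0 ^ 2 + y 1 ^ 2 < R ^ 2 - z ^ 2} := by
        rw [mem_ball_zero_iff, ← sq_lt_sq₀ (norm_nonneg _) hR, EuclideanSpace.real_norm_sq_eq,
          Fin.sum_univ_three]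
        simp [MeasurableEquiv.piFinSuccAbove, Fin.insertNthEquiv]
        have h2 : (Fin.cons z y : Fin 3 → ℝ) 2 = y 1 := rfl
        rw [h2]
        constructor <;> intro h <;> linarith
      beta_reduce
      by_cases hy : y ∈ {y : Fin 2 → ℝ | y 0 ^ 2 + y 1 ^ 2 < R ^ 2 - z ^ 2}
      · rw [indicator_of_mem (hm.2 hy), indicator_of_mem hy]
        rfl
      · rw [indicator_of_notMem fun h => hy (hm.1 h), indicator_of_notMem hy]
    · exact (e.integrable_comp_emb me).2 ((mt.integrable_comp_emb met).2 hint)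
  have h2 (z : ℝ) : (∫ y : Fin 2 → ℝ, ({y : Fin 2 → ℝ | y 0 ^ 2 + y 1 ^ 2 < R ^ 2 - z ^ 2}).indicator
        (fun _ => Complex.exp (Complex.I * z)) y) = (Ioc (-R) R).indicator
        (fun z => Complex.exp (Complex.I * z) * (Real.pi * (R ^ 2 - z ^ 2))) z := by
    rw [integral_indicator_const _ (by measurability), measureReal_def, volume_disc]
    by_cases hz : z ∈ Ioc (-R) R
    · rw [indicator_of_mem hz, ENNReal.toReal_ofReal, Complex.real_smul]
      · push_cast; ring
      · have := Real.pi_pos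
        have : 0 ≤ R ^ 2 - z ^ 2 := by nlinarith [hz.1, hz.2]
        positivity
    · rw [indicator_of_notMem hz, ENNReal.ofReal_of_nonpos, ENNReal.toReal_zero, zero_smul]
      refine mul_nonpos_of_nonneg_of_nonpos Real.pi_pos.le ?_
      by_contra! h
      have := abs_lt_of_sq_lt_sq (sub_pos.1 h) hR
      exact hz ⟨(abs_lt.1 this).1, (abs_lt.1 this).2.le⟩
  rw [h1]
  simp_rw [h2]
  rw [integral_indicator measurableSet_Ioc, ← intervalIntegral.integral_of_le (by linarith)]
  -- For `p = π (R² - z²)`, repeated integration by parts gives the antiderivative `e^{iz} (-i p +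
  -- p' + i p'')`.
  have h3 : ∀ z ∈ uIcc (-R) R, HasDerivAt (fun z : ℝ => Complex.exp (Complex.I * z) *
      (-Complex.I * (Real.pi * (R ^ 2 - z ^ 2)) - 2 * Real.pi * z - 2 * Real.pi * Complex.I))
      (Complex.exp (Complex.I * z) * (Real.pi * (R ^ 2 - z ^ 2))) z := by
    intro z _
    have hz : HasDerivAt (fun z : ℝ => (z : ℂ)) 1 z := Complex.ofRealCLM.hasDerivAt
    have := ((hz.const_mul Complex.I).cexp).mul (((((hz.pow 2).const_sub ((R : ℂ) ^ 2)).const_mul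
      (Real.pi : ℂ)).const_mul (-Complex.I) |>.sub (hz.const_mul (2 * Real.pi : ℂ))).sub_const
        (2 * Real.pi * Complex.I))
    refine this.congr_deriv ?_
    simp
    ring_nf
    simp
    ring
  rw [intervalIntegral.integral_eq_sub_of_hasDerivAt h3 (by
    apply Continuous.intervalIntegrable; fun_prop)]
  have e1 : Complex.exp (Complex.I * (R : ℝ)) = Complex.cos R + Complex.sin R * Complex.I := by
    rw [mul_comm, Complex.exp_mul_I]
  have e2 : Complex.exp (Complex.I * ((-R : ℝ) : ℂ)) = Complex.cos R - Complex.sin R * Complex.I := by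
    rw [mul_comm, Complex.exp_mul_I]; simp [sub_eq_add_neg]
  rw [e1, e2]
  push_cast
  ring_nf
  simp

/-- Two vectors of equal norm are exchanged by the reflection along their difference. By rotation
invariance, a plane wave in direction `e` may then be replaced by one along the first axis. -/
theorem exists_isometry_map_single {e : R3} (he : ‖e‖ = 1) :
    ∃ U : R3 ≃ₗᵢ[ℝ] R3, U e = EuclideanSpace.single 0 1 :=
  ⟨_, Submodule.reflection_sub (w := EuclideanSpace.single 0 1) (by simp [he])⟩

theorem integral_ball_exp_inner {e : R3} (he : ‖e‖ = 1) (R : ℝ) (hR : 0 ≤ R) :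
    ∫ x in ball (0 : R3) R, Complex.exp (Complex.I * (inner ℝ e x : ℝ)) =
      ((4 * Real.pi * (Real.sin R - R * Real.cos R) : ℝ) : ℂ) := by
  obtain ⟨U, hU⟩ := exists_isometry_map_single he
  have h := (U.measurePreserving).setIntegral_preimage_emb U.toHomeomorph.measurableEmbedding
    (fun x : R3 => Complex.exp (Complex.I * (x 0 : ℝ))) (ball 0 R)
  rw [U.preimage_ball, map_zero] at h
  rw [← integral_ball_exp R hR, ← h]
  refine setIntegral_congr_fun measurableSet_ball fun x _ => ?_
  rw [← U.inner_map_map, hU, EuclideanSpace.inner_single_left]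
  simp

theorem continuous_integral_sphere {X F : Type*} [TopologicalSpace X] [FirstCountableTopology X]
    [LocallyCompactSpace X]
    [NormedAddCommGroup F] [NormedSpace ℝ F]
    {f : X → sphere (0 : R3) 1 → F} (hf : Continuous f.uncurry) :
    Continuous fun x => ∫ n, f x n ∂(volume : Measure R3).toSphere := by
  have := continuous_parametric_integral_of_continuous
    (μ := (volume : Measure R3).toSphere) (f := f) hf (s := univ) isCompact_univ
  simpa using this

/-- The sphere integral is recovered from ball integrals: differentiating `∫₀^r s² f(s) ds = 4π (sin
r - r cos r)` at `R` gives `R² f(R) = 4π R sin R`. -/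
theorem integral_sphere_exp_unit {e : R3} (he : ‖e‖ = 1) {R : ℝ} (hR : 0 < R) :
    ∫ n : sphere (0 : R3) 1, Complex.exp (Complex.I * ((R * inner ℝ e (n : R3) : ℝ)))
      ∂(volume : Measure R3).toSphere = ((4 * Real.pi * Real.sin R / R : ℝ) : ℂ) := by
  set f : ℝ → ℂ := fun R => ∫ n : sphere (0 : R3) 1, Complex.exp
    (Complex.I * ((R * inner ℝ e (n : R3) : ℝ))) ∂(volume : Measure R3).toSphere with hf
  have hfc : Continuous f := continuous_integral_sphere (by unfold Function.uncurry; fun_prop)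
  have key : ∀ r : ℝ, 0 ≤ r → ∫ s in (0 : ℝ)..r, ((s ^ 2 : ℝ) : ℂ) * f s =
      ((4 * Real.pi * (Real.sin r - r * Real.cos r) : ℝ) : ℂ) := by
    intro r hr
    have hint : Integrable ((ball (0 : R3) r).indicator
        fun x => Complex.exp (Complex.I * (inner ℝ e x : ℝ))) := by
      rw [integrable_indicator_iff measurableSet_ball]
      have hc : Continuous fun x : R3 => Complex.exp (Complex.I * (inner ℝ e x : ℝ)) := by fun_prop
      exact (hc.continuousOn.integrableOn_compact
        (isCompact_closedBall (0 : R3) r)).mono_set ball_subset_closedBall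
    rw [← integral_ball_exp_inner he r hr, ← integral_indicator measurableSet_ball,
      integral_eq_integral_sphere hint, intervalIntegral.integral_of_le hr,
      integral_Ioc_eq_integral_Ioo, ← integral_indicator measurableSet_Ioo,
      ← integral_indicator measurableSet_Ioi]
    congr 1
    funext s
    by_cases hs : s ∈ Ioi (0 : ℝ)
    · rw [indicator_of_mem hs]
      replace hs := mem_Ioi.1 hs
      have hn (n : sphere (0 : R3) 1) : s • (n : R3) ∈ ball (0 : R3) r ↔ s < r := by
        simp [norm_smul, abs_of_pos hs]
      by_cases hsr : s < r
      · rw [indicator_of_mem (mem_Ioo.2 ⟨hs, hsr⟩)]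
        simp [indicator, hn, hsr, hf, inner_smul_right]
      · rw [indicator_of_notMem fun h => hsr h.2]
        simp [indicator, hn, hsr]
    · rw [indicator_of_notMem fun h => hs h.1, indicator_of_notMem hs]
  have hd1 : HasDerivAt (fun r => ∫ s in (0 : ℝ)..r, ((s ^ 2 : ℝ) : ℂ) * f s)
      (((R ^ 2 : ℝ) : ℂ) * f R) R :=
    intervalIntegral.integral_hasDerivAt_right (Continuous.intervalIntegrable (by fun_prop) _ _)
      (Continuous.stronglyMeasurableAtFilter (by fun_prop) _ _)
      (Continuous.continuousAt (by fun_prop))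
  have hd2 : HasDerivAt (fun r : ℝ => ((4 * Real.pi * (Real.sin r - r * Real.cos r) : ℝ) : ℂ))
      ((4 * Real.pi * (R * Real.sin R) : ℝ) : ℂ) R := by
    refine HasDerivAt.ofReal_comp ?_
    refine (((Real.hasDerivAt_sin R).sub ((hasDerivAt_id R).mul
      (Real.hasDerivAt_cos R))).const_mul (4 * Real.pi)).congr_deriv ?_
    simp
  have he := hd1.unique (hd2.congr_of_eventuallyEq
    ((eventually_gt_nhds hR).mono fun r hr => key r hr.le))
  have hR' : (R : ℂ) ≠ 0 := by exact_mod_cast hR.ne'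
  change f R = _
  push_cast at he ⊢
  rw [eq_div_iff hR']
  refine mul_left_cancel₀ hR' ?_
  linear_combination he

theorem integral_sphere_exp {q : R3} (hq : q ≠ 0) :
    ∫ n : sphere (0 : R3) 1, Complex.exp (Complex.I * (inner ℝ q (n : R3) : ℝ))
      ∂(volume : Measure R3).toSphere = ((4 * Real.pi * Real.sin ‖q‖ / ‖q‖ : ℝ) : ℂ) := by
  have hq' : 0 < ‖q‖ := norm_pos_iff.2 hq
  rw [← integral_sphere_exp_unit (e := ‖q‖⁻¹ • q) (by simp [norm_smul, hq'.ne']) hq']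
  simp [hq'.ne', inner_smul_left]

/-! ### The truncated Helmholtz kernel and its Fourier transform -/

/-- The Helmholtz kernel as a function of the difference `r - r'`. -/
noncomputable def differenceKernel (k : ℝ) (x : R3) : ℂ :=
  Complex.exp (-(Complex.I * k * ‖x‖)) / (4 * Real.pi * ‖x‖)

theorem helmholtzKernel_eq (k : ℝ) (r r' : R3) :
    helmholtzKernel k r r' = differenceKernel k (r - r') := rfl

theorem measurable_differenceKernel (k : ℝ) : Measurable (differenceKernel k) := by
  unfold differenceKernel
  fun_prop

theorem norm_exp_neg_I_mul (k s : ℝ) : ‖Complex.exp (-(Complex.I * k * s))‖ = 1 := by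
  have : -(Complex.I * k * s) = ((-(k * s) : ℝ) : ℂ) * Complex.I := by push_cast; ring
  rw [this, Complex.norm_exp_ofReal_mul_I]

theorem norm_differenceKernel (k : ℝ) (x : R3) :
    ‖differenceKernel k x‖ = (4 * Real.pi)⁻¹ * ‖x‖⁻¹ := by
  rw [differenceKernel, norm_div, norm_exp_neg_I_mul]
  simp [abs_of_pos Real.pi_pos, mul_comm]

/-- In polar coordinates the weight `r²` turns `r⁻¹` into `r`. -/
theorem integrableOn_norm_inv_ball (D : ℝ) :
    IntegrableOn (fun x : R3 => ‖x‖⁻¹) (ball 0 D) := by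
  rw [← integrable_indicator_iff measurableSet_ball]
  have h := integrable_fun_norm_addHaar (volume : Measure R3)
    (f := (Iio D).indicator fun r : ℝ => r⁻¹)
  have h2 : (ball (0 : R3) D).indicator (fun x : R3 => ‖x‖⁻¹) =
      fun x => (Iio D).indicator (fun r : ℝ => r⁻¹) ‖x‖ := by
    funext x
    simp [indicator]
  rw [h2, h]
  have h3 : IntegrableOn (fun y : ℝ => y) (Ioc 0 D) :=
    (continuous_id.integrableOn_Icc (a := (0:ℝ)) (b := D)).mono_set Ioc_subset_Icc_self
  rw [← integrable_indicator_iff measurableSet_Ioi]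
  rw [IntegrableOn, ← restrict_Ioo_eq_restrict_Ioc, ← IntegrableOn,
    ← integrable_indicator_iff measurableSet_Ioo] at h3
  refine h3.congr (Filter.Eventually.of_forall fun y => ?_)
  by_cases hy : 0 < y
  · by_cases hD : y < D
    · simp [indicator, hy, hD]
      field_simp
    · simp [indicator, hy, hD]
  · simp [indicator, hy]

/-- The Helmholtz kernel cut off outside the ball of radius `D`. -/
noncomputable def truncatedKernel (k D : ℝ) : R3 → ℂ := (ball 0 D).indicator (differenceKernel k)

theorem integrable_truncatedKernel (k D : ℝ) : Integrable (truncatedKernel k D) := by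
  rw [truncatedKernel, integrable_indicator_iff measurableSet_ball]
  refine ((integrableOn_norm_inv_ball D).const_mul ((4 * Real.pi)⁻¹)).mono'
    (measurable_differenceKernel k).aestronglyMeasurable
    (Filter.Eventually.of_forall fun x => (norm_differenceKernel k x).le)

/-- The derivative of `e^{-iks} cos(ts)` expresses `t` times the integral through two boundary terms
of modulus at most `1` and `k` times an integral of modulus at most `D`. -/
theorem norm_integral_exp_mul_sin_le (k : ℝ) {D t : ℝ} (hD : 0 ≤ D) (ht : 0 < t) :
    ‖∫ s in (0 : ℝ)..D, Complex.exp (-(Complex.I * k * s)) * Real.sin (t * s)‖ ≤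
      (2 + |k| * D) / t := by
  have hd : ∀ s ∈ uIcc 0 D, HasDerivAt
      (fun s : ℝ => Complex.exp (-(Complex.I * k * s)) * Real.cos (t * s))
      (-(Complex.I * k) * (Complex.exp (-(Complex.I * k * s)) * Real.cos (t * s)) -
        t * (Complex.exp (-(Complex.I * k * s)) * Real.sin (t * s))) s := by
    intro s _
    have hs : HasDerivAt (fun s : ℝ => (s : ℂ)) 1 s := Complex.ofRealCLM.hasDerivAt
    have hc : HasDerivAt (fun s : ℝ => ((Real.cos (t * s) : ℝ) : ℂ))
        ((-Real.sin (t * s) * t : ℝ) : ℂ) s :=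
      HasDerivAt.ofReal_comp (by simpa using ((hasDerivAt_id s).const_mul t).cos)
    refine (((hs.const_mul (Complex.I * k)).neg.cexp).mul hc).congr_deriv ?_
    simp only [Pi.neg_apply]
    push_cast
    ring
  have hi := intervalIntegral.integral_eq_sub_of_hasDerivAt hd
    (Continuous.intervalIntegrable (by fun_prop) _ _)
  rw [intervalIntegral.integral_sub (Continuous.intervalIntegrable (by fun_prop) _ _)
    (Continuous.intervalIntegrable (by fun_prop) _ _), intervalIntegral.integral_const_mul,
    intervalIntegral.integral_const_mul] at hi
  set A := ∫ s in (0 : ℝ)..D, Complex.exp (-(Complex.I * k * s)) * Real.cos (t * s)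
  set B := ∫ s in (0 : ℝ)..D, Complex.exp (-(Complex.I * k * s)) * Real.sin (t * s)
  have hbound (s : ℝ) : ‖Complex.exp (-(Complex.I * k * s)) * Real.cos (t * s)‖ ≤ 1 := by
    rw [norm_mul, norm_exp_neg_I_mul, one_mul, Complex.norm_real]
    exact Real.abs_cos_le_one _
  have hA : ‖A‖ ≤ D := by
    have := intervalIntegral.norm_integral_le_of_norm_le_const (a := 0) (b := D) (C := 1)
      (f := fun s : ℝ => Complex.exp (-(Complex.I * k * s)) * Real.cos (t * s))
      fun s _ => hbound s
    rwa [one_mul, sub_zero, abs_of_nonneg hD] at this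
  have hB : (t : ℂ) * B = -(Complex.I * k) * A -
      (Complex.exp (-(Complex.I * k * D)) * Real.cos (t * D)) +
      (Complex.exp (-(Complex.I * k * (0 : ℝ))) * Real.cos (t * 0)) := by
    linear_combination -hi
  rw [le_div_iff₀ ht]
  calc ‖B‖ * t = ‖(t : ℂ) * B‖ := by rw [norm_mul, Complex.norm_real, Real.norm_of_nonneg ht.le,
        mul_comm]
    _ ≤ ‖-(Complex.I * k) * A‖ + 1 + 1 := by
      rw [hB]
      refine (norm_add_le _ _).trans (add_le_add ((norm_sub_le _ _).trans ?_) (hbound 0))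
      exact add_le_add le_rfl (hbound D)
    _ ≤ 2 + |k| * D := by
      have : ‖-(Complex.I * k) * A‖ = |k| * ‖A‖ := by simp
      rw [this]
      nlinarith [mul_le_mul_of_nonneg_left hA (abs_nonneg k)]

/-- One factor `|q|⁻¹` comes from the spherical average of the plane wave, the other from the
oscillation of `sin(|q|s)`. The cutoff matters: the symbol `1 / (|q|² - k²)` of the full kernel is
singular on `|q| = k`. -/
theorem norm_integral_truncatedKernel_mul_exp_le (k : ℝ) {D : ℝ} (hD : 0 ≤ D) {q : R3}
    (hq : q ≠ 0) :
    ‖∫ x, truncatedKernel k D x * Complex.exp (Complex.I * (inner ℝ q x : ℝ))‖ ≤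
      (2 + |k| * D) / ‖q‖ ^ 2 := by
  have hq' : 0 < ‖q‖ := norm_pos_iff.2 hq
  have hint : Integrable fun x =>
      truncatedKernel k D x * Complex.exp (Complex.I * (inner ℝ q x : ℝ)) := by
    refine (integrable_truncatedKernel k D).mul_bdd (c := 1)
      (Continuous.aestronglyMeasurable (by fun_prop)) (Filter.Eventually.of_forall fun x => ?_)
    rw [mul_comm, Complex.norm_exp_ofReal_mul_I]
  have h : ∫ x, truncatedKernel k D x * Complex.exp (Complex.I * (inner ℝ q x : ℝ)) =
      (‖q‖ : ℂ)⁻¹ *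
        ∫ s in (0 : ℝ)..D, Complex.exp (-(Complex.I * k * s)) * Real.sin (‖q‖ * s) := by
    rw [integral_eq_integral_sphere hint, ← intervalIntegral.integral_const_mul,
      intervalIntegral.integral_of_le hD, integral_Ioc_eq_integral_Ioo,
      ← integral_indicator measurableSet_Ioo, ← integral_indicator measurableSet_Ioi]
    congr 1
    funext s
    by_cases hs : s ∈ Ioi (0 : ℝ)
    · rw [indicator_of_mem hs]
      replace hs := mem_Ioi.1 hs
      have hn (n : sphere (0 : R3) 1) : ‖s • (n : R3)‖ = s := by
        simp [norm_smul, abs_of_pos hs]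
      by_cases hsr : s < D
      · have hk (n : sphere (0 : R3) 1) : truncatedKernel k D (s • (n : R3)) =
            Complex.exp (-(Complex.I * k * s)) / (4 * Real.pi * s) := by
          rw [truncatedKernel, indicator_of_mem (by rwa [mem_ball_zero_iff, hn]),
            differenceKernel, hn]
        rw [indicator_of_mem (mem_Ioo.2 ⟨hs, hsr⟩)]
        have hsq := integral_sphere_exp (q := s • q) (smul_ne_zero hs.ne' hq)
        simp_rw [real_inner_smul_left, ← real_inner_smul_right] at hsq
        simp_rw [hk]
        rw [integral_const_mul, hsq, norm_smul, Real.norm_of_nonneg hs.le]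
        have h1 : (s : ℂ) ≠ 0 := by exact_mod_cast hs.ne'
        have h2 : (‖q‖ : ℂ) ≠ 0 := by exact_mod_cast hq'.ne'
        have h3 : (Real.pi : ℂ) ≠ 0 := by exact_mod_cast Real.pi_ne_zero
        push_cast
        field_simp
      · have hk (n : sphere (0 : R3) 1) : truncatedKernel k D (s • (n : R3)) = 0 := by
          rw [truncatedKernel, indicator_of_notMem (by rwa [mem_ball_zero_iff, hn])]
        rw [indicator_of_notMem fun h => hsr h.2]
        simp [hk]
    · rw [indicator_of_notMem hs, indicator_of_notMem fun h => hs h.1]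
  rw [h, norm_mul, norm_inv, Complex.norm_real, norm_norm]
  calc ‖q‖⁻¹ * _ ≤ ‖q‖⁻¹ * ((2 + |k| * D) / ‖q‖) := by
        gcongr
        exact norm_integral_exp_mul_sin_le k hD hq'
    _ = _ := by field_simp

/-! ### Algebra of `ℂ³` -/

theorem cross_apply_zero (n : R3) (v : C3) : cross n v 0 = n 1 * v 2 - n 2 * v 1 := by
  simp [cross, crossProduct]

theorem cross_apply_one (n : R3) (v : C3) : cross n v 1 = n 2 * v 0 - n 0 * v 2 := by
  simp [cross, crossProduct]

theorem cross_apply_two (n : R3) (v : C3) : cross n v 2 = n 0 * v 1 - n 1 * v 0 := by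
  simp [cross, crossProduct]

theorem dot_eq (a b : C3) : dot a b = a 0 * b 0 + a 1 * b 1 + a 2 * b 2 := by
  simp [dot, Fin.sum_univ_three]

theorem dot_comm (a b : C3) : dot a b = dot b a := by simp only [dot_eq]; ring

/-- Componentwise complex conjugation. -/
noncomputable def conjField (v : C3) : C3 := WithLp.toLp 2 fun i => conj (v i)

@[simp] theorem conjField_apply (v : C3) (i : Fin 3) : conjField v i = conj (v i) := rfl

theorem norm_conjField (v : C3) : ‖conjField v‖ = ‖v‖ := by
  simp [EuclideanSpace.norm_eq]

theorem inner_eq_dot (a b : C3) : inner ℂ a b = dot (conjField a) b := by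
  simp [PiLp.inner_apply, dot, mul_comm]

theorem dot_eq_inner (a b : C3) : dot a b = inner ℂ (conjField a) b := by
  simp [PiLp.inner_apply, dot, mul_comm]

theorem norm_dot_le (a b : C3) : ‖dot a b‖ ≤ ‖a‖ * ‖b‖ := by
  rw [dot_eq_inner, ← norm_conjField a]
  exact norm_inner_le_norm _ _

theorem conj_dot (a b : C3) : conj (dot a b) = dot (conjField a) (conjField b) := by
  simp [dot]

/-- The bilinear dot product as a continuous bilinear map. -/
noncomputable def dotL : C3 →L[ℂ] C3 →L[ℂ] ℂ :=
  LinearMap.mkContinuous₂ (LinearMap.mk₂ ℂ dot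
    (fun a b c => by simp [dot_eq]; ring) (fun a b c => by simp [dot_eq]; ring)
    (fun a b c => by simp [dot_eq]; ring) (fun a b c => by simp [dot_eq]; ring)) 1
    fun a b => by simpa using norm_dot_le a b

@[simp] theorem dotL_apply (a b : C3) : dotL a b = dot a b := rfl

theorem dot_smul (c : ℂ) (a b : C3) : dot a (c • b) = c * dot a b := (dotL a).map_smul c b

theorem smul_dot (c : ℂ) (a b : C3) : dot (c • a) b = c * dot a b := by
  rw [dot_comm, dot_smul, dot_comm]

theorem ext_dot {a b : C3} (h : ∀ v, dot v a = dot v b) : a = b := by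
  ext i
  simpa [dot] using h (EuclideanSpace.single i 1)

theorem continuous_dot : Continuous fun p : C3 × C3 => dot p.1 p.2 := by
  unfold dot; fun_prop

/-- Taking the cross product with a real vector is skew-adjoint. This is the positivity of the
symbol of the double curl. -/
theorem norm_sq_cross (n : R3) (v : C3) :
    ((‖cross n v‖ ^ 2 : ℝ) : ℂ) = inner ℂ (-cross n (cross n v)) v := by
  rw [inner_eq_dot, EuclideanSpace.norm_sq_eq, Fin.sum_univ_three, dot_eq]
  push_cast
  simp only [← Complex.conj_mul', conjField_apply, PiLp.neg_apply, cross_apply_zero,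
    cross_apply_one, cross_apply_two, map_sub, map_mul, map_neg, Complex.conj_ofReal]
  ring

theorem norm_cross_le (n : R3) (v : C3) : ‖cross n v‖ ≤ ‖n‖ * ‖v‖ := by
  rw [← sq_le_sq₀ (norm_nonneg _) (by positivity), mul_pow]
  -- Lagrange's identity.
  have h : ((‖n‖ ^ 2 * ‖v‖ ^ 2 : ℝ) : ℂ) = ((‖cross n v‖ ^ 2 +
      ‖(n 0 : ℂ) * v 0 + n 1 * v 1 + n 2 * v 2‖ ^ 2 : ℝ) : ℂ) := by
    rw [EuclideanSpace.norm_sq_eq, EuclideanSpace.norm_sq_eq, EuclideanSpace.norm_sq_eq,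
      Fin.sum_univ_three, Fin.sum_univ_three, Fin.sum_univ_three]
    simp only [Real.norm_eq_abs, sq_abs]
    push_cast
    simp only [← Complex.conj_mul', cross_apply_zero,
      cross_apply_one, cross_apply_two, map_sub, map_add, map_mul, Complex.conj_ofReal]
    ring
  have h' := Complex.ofReal_injective h
  rw [h']
  exact le_add_of_nonneg_right (by positivity)

theorem norm_cross_cross_le (n : R3) (v : C3) : ‖cross n (cross n v)‖ ≤ ‖n‖ ^ 2 * ‖v‖ := by
  refine (norm_cross_le _ _).trans ?_
  rw [pow_two, mul_assoc]
  exact mul_le_mul_of_nonneg_left (norm_cross_le _ _) (norm_nonneg _)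

/-! ### The curl of smooth fields -/

section Curl

variable {F H : R3 → C3}

theorem partialDeriv_eq {r : R3} (hF : DifferentiableAt ℝ F r) (i j : Fin 3) :
    partialDeriv i j F r = fderiv ℝ (fun x => F x j) r (EuclideanSpace.single i 1) := by
  have h := ((EuclideanSpace.proj j : C3 →L[ℂ] ℂ).restrictScalars ℝ).hasFDerivAt.comp r
    hF.hasFDerivAt
  have h2 : fderiv ℝ (fun x => F x j) r = _ := h.fderiv
  rw [h2]
  rfl

theorem contDiff_partialDeriv (hF : ContDiff ℝ ∞ F) (i j : Fin 3) :
    ContDiff ℝ ∞ (partialDeriv i j F) := by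
  have h : ContDiff ℝ ∞ fun r => fderiv ℝ F r (EuclideanSpace.single i 1) :=
    (hF.fderiv_right (m := ∞) (by simp)).clm_apply contDiff_const
  exact ((EuclideanSpace.proj j : C3 →L[ℂ] ℂ).restrictScalars ℝ).contDiff.comp h

theorem curl_apply_zero (F : R3 → C3) (r : R3) :
    curl F r 0 = partialDeriv 1 2 F r - partialDeriv 2 1 F r := rfl

theorem curl_apply_one (F : R3 → C3) (r : R3) :
    curl F r 1 = partialDeriv 2 0 F r - partialDeriv 0 2 F r := rfl

theorem curl_apply_two (F : R3 → C3) (r : R3) :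
    curl F r 2 = partialDeriv 0 1 F r - partialDeriv 1 0 F r := rfl

theorem contDiff_curl (hF : ContDiff ℝ ∞ F) : ContDiff ℝ ∞ (curl F) := by
  refine (contDiff_piLp 2).2 fun i => ?_
  fin_cases i
  · exact (contDiff_partialDeriv hF 1 2).sub (contDiff_partialDeriv hF 2 1)
  · exact (contDiff_partialDeriv hF 2 0).sub (contDiff_partialDeriv hF 0 2)
  · exact (contDiff_partialDeriv hF 0 1).sub (contDiff_partialDeriv hF 1 0)

theorem curl_congr_partialDeriv {r s : R3}
    (h : ∀ i j, partialDeriv i j F r = partialDeriv i j H s) : curl F r = curl H s := by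
  simp only [curl, h]

theorem tsupport_curl_subset (F : R3 → C3) : tsupport (curl F) ⊆ tsupport F := by
  refine closure_minimal (fun r hr => ?_) (isClosed_tsupport F)
  by_contra h
  refine hr ?_
  have h0 : fderiv ℝ F r = 0 := by
    by_contra h1
    exact h (support_fderiv_subset ℝ (f := F) h1)
  ext i
  fin_cases i <;> simp [curl, partialDeriv, h0]

theorem IsTestField.curl {V : Set R3} (hF : IsTestField V F) : IsTestField V (curl F) :=
  ⟨contDiff_curl hF.1, hF.2.1.mono' ((subset_tsupport _).trans (tsupport_curl_subset F)),
    (tsupport_curl_subset F).trans hF.2.2⟩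

theorem partialDeriv_comp_add_right (F : R3 → C3) (i j : Fin 3) (s r : R3) :
    partialDeriv i j (fun x => F (x + s)) r = partialDeriv i j F (r + s) := by
  rw [partialDeriv, fderiv_comp_add_right, partialDeriv]

theorem curl_comp_add_right (F : R3 → C3) (s : R3) :
    curl (fun x => F (x + s)) = fun x => curl F (x + s) := by
  funext r
  exact curl_congr_partialDeriv fun i j => partialDeriv_comp_add_right F i j s r

theorem curl_add (hF : Differentiable ℝ F) (hH : Differentiable ℝ H) :
    curl (F + H) = curl F + curl H := by
  funext r
  have h (i j) : partialDeriv i j (F + H) r = partialDeriv i j F r + partialDeriv i j H r := by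
    rw [partialDeriv, fderiv_add (hF r) (hH r)]; rfl
  ext i
  fin_cases i <;> simp [curl, h] <;> ring

theorem curl_const_smul (hF : Differentiable ℝ F) (c : ℂ) : curl (c • F) = c • curl F := by
  funext r
  have h (i j) : partialDeriv i j (c • F) r = c * partialDeriv i j F r := by
    rw [partialDeriv, fderiv_const_smul (hF r)]; rfl
  ext i
  fin_cases i <;> simp [curl, h] <;> ring

/-- Componentwise complex conjugation as a real-linear isometry. -/
noncomputable def conjL : C3 →L[ℝ] C3 :=
  LinearMap.mkContinuous
    { toFun := conjField
      map_add' := fun a b => by ext i; simp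
      map_smul' := fun c a => by ext i; simp } 1 fun v => by simp [norm_conjField]

theorem conjL_apply (v : C3) : conjL v = conjField v := rfl

theorem curl_conjField (hF : Differentiable ℝ F) :
    curl (fun r => conjField (F r)) = fun r => conjField (curl F r) := by
  funext r
  have h (i j) : partialDeriv i j (fun r => conjField (F r)) r = conj (partialDeriv i j F r) := by
    have h1 : fderiv ℝ (fun r => conjField (F r)) r = _ :=
      (conjL.hasFDerivAt.comp r (hF r).hasFDerivAt).fderiv
    rw [partialDeriv, h1]; rfl
  ext i
  fin_cases i <;> simp [curl, h]

theorem IsTestField.conjField {V : Set R3} (hF : IsTestField V F) :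
    IsTestField V fun r => conjField (F r) := by
  have hs : Function.support (fun r => BornScattering.conjField (F r)) ⊆ Function.support F := by
    intro r hr h0
    refine hr ?_
    ext i
    simp [h0]
  exact ⟨conjL.contDiff.comp hF.1, hF.2.1.mono hs, (closure_mono hs).trans hF.2.2⟩

/-! ### Integration by parts -/

theorem integral_mul_partialDeriv (hF : ContDiff ℝ ∞ F) (hH : ContDiff ℝ ∞ H)
    (hHc : HasCompactSupport H) (i j l : Fin 3) :
    ∫ r, F r l * partialDeriv i j H r = - ∫ r, partialDeriv i l F r * H r j := by
  have hF' := hF.differentiable (by simp)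
  have hH' := hH.differentiable (by simp)
  have hFl : ContDiff ℝ ∞ fun r => F r l :=
    ((EuclideanSpace.proj l : C3 →L[ℂ] ℂ).restrictScalars ℝ).contDiff.comp hF
  have hHj : ContDiff ℝ ∞ fun r => H r j :=
    ((EuclideanSpace.proj j : C3 →L[ℂ] ℂ).restrictScalars ℝ).contDiff.comp hH
  have hc : HasCompactSupport fun r => H r j := hHc.mono fun r hr h0 => hr (by simp [h0])
  have hc' : HasCompactSupport (partialDeriv i j H) :=
    hHc.mono' fun r hr => support_fderiv_subset ℝ fun h0 => hr (by simp [partialDeriv, h0])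
  simp_rw [partialDeriv_eq (hF' _), partialDeriv_eq (hH' _)]
  refine integral_mul_fderiv_eq_neg_fderiv_mul_of_integrable ?_ ?_ ?_
    (fun x _ => (hFl.differentiable (by simp)) x) (fun x _ => (hHj.differentiable (by simp)) x)
  · simp_rw [← partialDeriv_eq (hF' _)]
    exact ((contDiff_partialDeriv hF i l).continuous.mul hHj.continuous).integrable_of_hasCompactSupport
      hc.mul_left
  · simp_rw [← partialDeriv_eq (hH' _)]
    exact (hFl.continuous.mul (contDiff_partialDeriv hH i j).continuous).integrable_of_hasCompactSupport
      hc'.mul_left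
  · exact (hFl.continuous.mul hHj.continuous).integrable_of_hasCompactSupport hc.mul_left

theorem integral_sub_add_sub_add_sub {a b c d e f : R3 → ℂ} (ha : Integrable a)
    (hb : Integrable b) (hc : Integrable c) (hd : Integrable d) (he : Integrable e)
    (hf : Integrable f) : ∫ r, (a r - b r + (c r - d r) + (e r - f r)) =
      (∫ r, a r) - (∫ r, b r) + ((∫ r, c r) - ∫ r, d r) + ((∫ r, e r) - ∫ r, f r) := by
  have h := integral_add ((ha.sub hb).add (hc.sub hd)) (he.sub hf)
  simp only [Pi.add_apply, Pi.sub_apply] at h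
  have h' := integral_add (ha.sub hb) (hc.sub hd)
  simp only [Pi.sub_apply] at h'
  rw [h, h', integral_sub ha hb, integral_sub hc hd, integral_sub he hf]

/-- The sign from integration by parts cancels against the antisymmetry of the curl. Only `H` has
compact support, so that `F` may be a plane wave. -/
theorem integral_dot_curl (hF : ContDiff ℝ ∞ F) (hH : ContDiff ℝ ∞ H)
    (hHc : HasCompactSupport H) :
    ∫ r, dot (F r) (curl H r) = ∫ r, dot (curl F r) (H r) := by
  have hFl (l) : ContDiff ℝ ∞ fun r => F r l :=
    ((EuclideanSpace.proj l : C3 →L[ℂ] ℂ).restrictScalars ℝ).contDiff.comp hF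
  have hHj (j) : ContDiff ℝ ∞ fun r => H r j :=
    ((EuclideanSpace.proj j : C3 →L[ℂ] ℂ).restrictScalars ℝ).contDiff.comp hH
  have hc (j) : HasCompactSupport fun r => H r j := hHc.mono fun r hr h0 => hr (by simp [h0])
  have hc' (i j) : HasCompactSupport (partialDeriv i j H) :=
    hHc.mono' fun r hr => support_fderiv_subset ℝ fun h0 => hr (by simp [partialDeriv, h0])
  have h1 (i l j) : Integrable fun r => partialDeriv i l F r * H r j :=
    ((contDiff_partialDeriv hF i l).continuous.mul (hHj j).continuous).integrable_of_hasCompactSupport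
      (hc j).mul_left
  have h2 (i j l) : Integrable fun r => F r l * partialDeriv i j H r :=
    ((hFl l).continuous.mul (contDiff_partialDeriv hH i j).continuous).integrable_of_hasCompactSupport
      (hc' i j).mul_left
  simp only [dot_eq, curl_apply_zero, curl_apply_one, curl_apply_two, mul_sub, sub_mul]
  rw [integral_sub_add_sub_add_sub (h2 _ _ _) (h2 _ _ _) (h2 _ _ _) (h2 _ _ _) (h2 _ _ _)
    (h2 _ _ _), integral_sub_add_sub_add_sub (h1 _ _ _) (h1 _ _ _) (h1 _ _ _) (h1 _ _ _)
    (h1 _ _ _) (h1 _ _ _)]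
  simp only [integral_mul_partialDeriv hF hH hHc]
  ring

theorem integral_dot_curl_curl (hF : ContDiff ℝ ∞ F) (hH : ContDiff ℝ ∞ H)
    (hHc : HasCompactSupport H) :
    ∫ r, dot (F r) (curl (curl H) r) = ∫ r, dot (curl (curl F) r) (H r) := by
  have hT : IsTestField univ H := ⟨hH, hHc, subset_univ _⟩
  rw [integral_dot_curl hF hT.curl.1 hT.curl.2.1, integral_dot_curl (contDiff_curl hF) hH hHc]

end Curl

/-! ### Fourier transforms of test fields -/

/-- The plane wave `r ↦ e^{iq·r} v`. -/
noncomputable def planeWave (q : R3) (v : C3) (r : R3) : C3 :=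
  Complex.exp (Complex.I * (inner ℝ q r : ℝ)) • v

theorem contDiff_planeWave (q : R3) (v : C3) : ContDiff ℝ ∞ (planeWave q v) := by
  unfold planeWave
  have : ContDiff ℝ ∞ fun r : R3 => Complex.exp (Complex.I * (inner ℝ q r : ℝ)) :=
    (contDiff_const.mul (Complex.ofRealCLM.contDiff.comp
      (contDiff_const.inner ℝ contDiff_id))).cexp
  exact this.smul contDiff_const

theorem curl_planeWave (q : R3) (v : C3) :
    curl (planeWave q v) = planeWave q (Complex.I • cross q v) := by
  funext r
  have h (i j) : partialDeriv i j (planeWave q v) r =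
      Complex.I * q i * (Complex.exp (Complex.I * (inner ℝ q r : ℝ)) * v j) := by
    have h1 : HasFDerivAt (fun r : R3 => Complex.exp (Complex.I * (inner ℝ q r : ℝ)))
        (Complex.exp (Complex.I * (inner ℝ q r : ℝ)) •
          (Complex.I • (Complex.ofRealCLM.comp (innerSL ℝ q)))) r :=
      ((Complex.ofRealCLM.comp (innerSL ℝ q)).hasFDerivAt.const_mul Complex.I).cexp
    have h2 : fderiv ℝ (planeWave q v) r = _ := (h1.smul_const v).fderiv
    rw [partialDeriv, h2]
    simp [EuclideanSpace.inner_single_right]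
    ring
  ext i
  fin_cases i <;> simp [curl, h, planeWave, cross, crossProduct] <;> ring

theorem integrable_exp_smul {μ : Measure R3} {E : R3 → C3} (hE : Integrable E μ) (q : R3) :
    Integrable (fun r => Complex.exp (Complex.I * (inner ℝ q r : ℝ)) • E r) μ := by
  have hc : Continuous fun r : R3 => Complex.exp (Complex.I * (inner ℝ q r : ℝ)) := by fun_prop
  refine hE.bdd_smul 1 hc.aestronglyMeasurable (Filter.Eventually.of_forall fun x => ?_)
  rw [mul_comm, Complex.norm_exp_ofReal_mul_I]

theorem IsTestField.integrable {V : Set R3} {φ : R3 → C3} (hφ : IsTestField V φ)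
    (μ : Measure R3) [IsFiniteMeasureOnCompacts μ] : Integrable φ μ :=
  hφ.1.continuous.integrable_of_hasCompactSupport hφ.2.1

theorem IsTestField.eq_zero_of_notMem {V : Set R3} {φ : R3 → C3} (hφ : IsTestField V φ)
    {r : R3} (hr : r ∉ V) : φ r = 0 :=
  image_eq_zero_of_notMem_tsupport fun h => hr (hφ.2.2 h)

theorem IsTestField.fourier_eq {V : Set R3} {φ : R3 → C3} (hφ : IsTestField V φ) (q : R3) :
    fourier V φ q = ∫ r, Complex.exp (Complex.I * (inner ℝ q r : ℝ)) • φ r :=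
  setIntegral_eq_integral_of_forall_compl_eq_zero fun r hr => by
    rw [hφ.eq_zero_of_notMem hr, smul_zero]

theorem IsTestField.dot_fourier {V : Set R3} {φ : R3 → C3} (hφ : IsTestField V φ) (q : R3)
    (v : C3) : dot v (fourier V φ q) = ∫ r, dot (planeWave q v r) (φ r) := by
  rw [hφ.fourier_eq, ← dotL_apply, ← ContinuousLinearMap.integral_comp_comm _
    (integrable_exp_smul (hφ.integrable _) q)]
  simp only [dotL_apply, planeWave, smul_dot, dot_smul]

/-- Pairing with a constant vector `v` gives an integral against a plane wave. Both curls move onto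
that wave, where each acts as `i q × ·`. -/
theorem IsTestField.fourier_curl_curl {V : Set R3} {φ : R3 → C3} (hφ : IsTestField V φ) (q : R3) :
    fourier V (BornScattering.curl (BornScattering.curl φ)) q =
      -cross q (cross q (fourier V φ q)) := by
  refine ext_dot fun v => ?_
  rw [hφ.curl.curl.dot_fourier, integral_dot_curl_curl (contDiff_planeWave q v) hφ.1 hφ.2.1,
    curl_planeWave, curl_planeWave, ← hφ.dot_fourier]
  simp only [dot_eq, PiLp.smul_apply, PiLp.neg_apply, cross_apply_zero, cross_apply_one,
    cross_apply_two, smul_eq_mul]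
  ring_nf
  simp
  ring

/-! ### The `L²` bound on the double curl of the potential -/

/-- With Mathlib's phase `e^{-2πi⟨x, ξ⟩}`, the wave vector is `q = -2πξ` for `𝓕` and `q = 2πξ` for
`𝓕⁻`. -/
theorem norm_fourier_truncatedKernel_le (k : ℝ) {D : ℝ} (hD : 0 ≤ D) {ξ : R3} (hξ : ξ ≠ 0) :
    ‖𝓕 (truncatedKernel k D) ξ‖ ≤ (2 + |k| * D) / ‖(2 * Real.pi) • ξ‖ ^ 2 := by
  have h := norm_integral_truncatedKernel_mul_exp_le k hD (q := -((2 * Real.pi) • ξ))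
    (neg_ne_zero.2 (smul_ne_zero (by positivity) hξ))
  rw [norm_neg] at h
  refine le_of_eq_of_le ?_ h
  rw [Real.fourier_eq']
  congr 2
  funext x
  rw [inner_neg_left, real_inner_smul_left, real_inner_comm, smul_eq_mul, mul_comm]
  push_cast
  ring_nf

theorem IsTestField.fourierInv_eq {V : Set R3} {φ : R3 → C3} (hφ : IsTestField V φ) (ξ : R3) :
    𝓕⁻ φ ξ = fourier V φ ((2 * Real.pi) • ξ) := by
  rw [hφ.fourier_eq, Real.fourierInv_eq']
  congr 1
  funext x
  rw [real_inner_smul_left, real_inner_comm, mul_comm Complex.I]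

theorem IsTestField.norm_fourierInv_curl_curl_le {V : Set R3} {φ : R3 → C3}
    (hφ : IsTestField V φ) (ξ : R3) :
    ‖𝓕⁻ (BornScattering.curl (BornScattering.curl φ)) ξ‖ ≤
      ‖(2 * Real.pi) • ξ‖ ^ 2 * ‖𝓕⁻ φ ξ‖ := by
  rw [hφ.curl.curl.fourierInv_eq, hφ.fourier_curl_curl, hφ.fourierInv_eq, norm_neg]
  exact norm_cross_cross_le _ _

/-- The decay `|q|⁻²` of the kernel's transform absorbs the growth `|q|²` of the double curl.
Cauchy–Schwarz and Plancherel then give a constant depending only on `k` and `D`. -/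
theorem norm_integral_dot_convolution_le {V : Set R3} (k : ℝ) {D : ℝ} (hD : 0 ≤ D)
    {E φ : R3 → C3} (hE : IsTestField V E) (hφ : IsTestField V φ) :
    ‖∫ r, dot ((truncatedKernel k D ⋆[ContinuousLinearMap.lsmul ℂ ℂ] E) r) (curl (curl φ) r)‖ ≤
      (2 + |k| * D) * (√(∫ r, ‖E r‖ ^ 2) * √(∫ r, ‖φ r‖ ^ 2)) := by
  set ψ := curl (curl φ) with hψ
  have hψt : IsTestField V ψ := hφ.curl.curl
  -- Schwartz maps provide Fourier inversion, Plancherel and integrability of the transforms.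
  let sE := hE.2.1.toSchwartzMap hE.1
  let sφ := hφ.2.1.toSchwartzMap hφ.1
  let sψ := hψt.2.1.toSchwartzMap hψt.1
  have hEs (ξ : R3) : 𝓕 sE ξ = 𝓕 E ξ := congrFun (SchwartzMap.fourier_coe sE) ξ
  have hφs (ξ : R3) : 𝓕⁻ sφ ξ = 𝓕⁻ φ ξ := congrFun (SchwartzMap.fourierInv_coe sφ) ξ
  have hψs (ξ : R3) : 𝓕⁻ sψ ξ = 𝓕⁻ ψ ξ := congrFun (SchwartzMap.fourierInv_coe sψ) ξ
  have hκ := integrable_truncatedKernel k D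
  have hEi : Integrable E := hE.integrable _
  have hN : Integrable (truncatedKernel k D ⋆[ContinuousLinearMap.lsmul ℂ ℂ] E) :=
    hκ.integrable_convolution _ hEi
  -- The pairing is bilinear, without conjugation, so `𝓕` on one factor goes with `𝓕⁻` on the other.
  have h1 : ∫ r, dot ((truncatedKernel k D ⋆[ContinuousLinearMap.lsmul ℂ ℂ] E) r) (ψ r) =
      ∫ ξ, dot (𝓕 (truncatedKernel k D) ξ • 𝓕 E ξ) (𝓕⁻ ψ ξ) := by
    have h := VectorFourier.integral_bilin_fourierIntegral_eq_flip dotL (L := innerₗ R3)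
      Real.continuous_fourierChar continuous_inner hN
      ((𝓕⁻ sψ).integrable (μ := volume))
    have h2 (x : R3) : VectorFourier.fourierIntegral Real.fourierChar volume (innerₗ R3).flip
        (fun ξ => (𝓕⁻ sψ : SchwartzMap R3 C3) ξ) x = ψ x := by
      rw [flip_innerₗ]
      exact DFunLike.congr_fun (show (𝓕 (𝓕⁻ sψ : SchwartzMap R3 C3) : SchwartzMap R3 C3) = sψ from
        FourierTransform.fourier_fourierInv_eq sψ) x
    simp_rw [h2] at h
    simp only [dotL_apply] at h
    rw [← h]
    congr 1
    funext ξ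
    rw [hψs, ← Real.fourier_smul_convolution_eq hκ hEi]
    rfl
  have hpt (ξ : R3) : ‖dot (𝓕 (truncatedKernel k D) ξ • 𝓕 E ξ) (𝓕⁻ ψ ξ)‖ ≤
      (2 + |k| * D) * (‖𝓕 sE ξ‖ * ‖𝓕⁻ sφ ξ‖) := by
    rw [hEs, hφs]
    have h3 := hφ.norm_fourierInv_curl_curl_le ξ
    refine (norm_dot_le _ _).trans ?_
    rw [norm_smul]
    -- At `ξ = 0` the kernel bound is unavailable, but there the transform of the double curl
    -- vanishes.
    rcases eq_or_ne ξ 0 with rfl | hξ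
    · have h4 : ‖𝓕⁻ ψ 0‖ ≤ 0 := by simpa using h3
      rw [le_antisymm h4 (norm_nonneg _), mul_zero]
      positivity
    · have h5 : 0 < ‖(2 * Real.pi) • ξ‖ ^ 2 := by
        have := norm_pos_iff.2 (smul_ne_zero (show 2 * Real.pi ≠ 0 by positivity) hξ)
        positivity
      calc ‖𝓕 (truncatedKernel k D) ξ‖ * ‖𝓕 E ξ‖ * ‖𝓕⁻ ψ ξ‖
          ≤ (2 + |k| * D) / ‖(2 * Real.pi) • ξ‖ ^ 2 * ‖𝓕 E ξ‖ *
            (‖(2 * Real.pi) • ξ‖ ^ 2 * ‖𝓕⁻ φ ξ‖) := by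
            gcongr
            exact norm_fourier_truncatedKernel_le k hD hξ
        _ = (2 + |k| * D) * (‖𝓕 E ξ‖ * ‖𝓕⁻ φ ξ‖) := by
            set m := ‖(2 * Real.pi) • ξ‖ ^ 2
            field_simp
  have hprod : Integrable fun ξ => ‖𝓕 sE ξ‖ * ‖𝓕⁻ sφ ξ‖ :=
    ((𝓕 sE).memLp 2).norm.integrable_mul ((𝓕⁻ sφ).memLp 2).norm
  rw [h1]
  refine (norm_integral_le_of_norm_le (hprod.const_mul _) (Filter.Eventually.of_forall hpt)).trans ?_
  rw [integral_const_mul]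
  refine mul_le_mul_of_nonneg_left ?_ (by positivity)
  have hcs := integral_mul_norm_le_Lp_mul_Lq (μ := volume) Real.HolderConjugate.two_two
    (f := (𝓕 sE : SchwartzMap R3 C3)) (g := (𝓕⁻ sφ : SchwartzMap R3 C3)) (by simpa using (𝓕 sE).memLp 2) (by simpa using (𝓕⁻ sφ).memLp 2)
  simp only [Real.rpow_two, ← Real.sqrt_eq_rpow] at hcs
  rw [SchwartzMap.integral_norm_sq_fourier, ← SchwartzMap.integral_norm_sq_fourier (𝓕⁻ sφ),
    FourierTransform.fourier_fourierInv_eq] at hcs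
  exact hcs

/-! ### Convolution with an integrable kernel -/

/-- The convolution of a scalar kernel with a field. -/
noncomputable def conv (κ : R3 → ℂ) (F : R3 → C3) : R3 → C3 :=
  κ ⋆[ContinuousLinearMap.lsmul ℂ ℂ] F

theorem conv_apply (κ : R3 → ℂ) (F : R3 → C3) (r : R3) :
    conv κ F r = ∫ t, κ t • F (r - t) := rfl

theorem conv_apply_swap (κ : R3 → ℂ) (F : R3 → C3) (r : R3) :
    conv κ F r = ∫ t, κ (r - t) • F t := by
  rw [conv_apply, ← integral_sub_left_eq_self _ volume r]
  simp

section Conv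

variable {κ : R3 → ℂ} {E g : R3 → C3}

theorem IsTestField.exists_norm_le {V : Set R3} (hg : IsTestField V g) : ∃ M, ∀ r, ‖g r‖ ≤ M :=
  hg.1.continuous.bounded_above_of_compact_support hg.2.1

theorem IsTestField.continuous_conv {V : Set R3} (hκ : Integrable κ) (hg : IsTestField V g) :
    Continuous (conv κ g) :=
  hg.2.1.continuous_convolution_right _ hκ.locallyIntegrable hg.1.continuous

theorem integrable_conv_integrand (hκ : Integrable κ) {V : Set R3} (hg : IsTestField V g)
    (r : R3) : Integrable fun t => κ t • g (r - t) :=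
  hg.2.1.convolutionExists_right (ContinuousLinearMap.lsmul ℂ ℂ) hκ.locallyIntegrable
    hg.1.continuous r

theorem integrable_conv_integrand_swap (hκ : Integrable κ) {V : Set R3} (hg : IsTestField V g)
    (r : R3) : Integrable fun t => κ (r - t) • g t := by
  have h := (integrable_conv_integrand hκ hg r).comp_sub_left r
  simpa using h

theorem IsTestField.conv_add {V : Set R3} (hκ : Integrable κ) (hE : IsTestField V E)
    (hg : IsTestField V g) : conv κ (E + g) = conv κ E + conv κ g := by
  funext r
  simp only [conv_apply, Pi.add_apply, smul_add]
  exact integral_add (integrable_conv_integrand hκ hE r) (integrable_conv_integrand hκ hg r)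

theorem conv_const_smul (c : ℂ) : conv κ (c • g) = c • conv κ g := convolution_smul

theorem dot_conv {V : Set R3} (hκ : Integrable κ) (hg : IsTestField V g) (v : C3) (r : R3) :
    dot v (conv κ g r) = ∫ t, κ t * dot v (g (r - t)) := by
  rw [conv_apply, ← dotL_apply, ← ContinuousLinearMap.integral_comp_comm _
    (integrable_conv_integrand hκ hg r)]
  simp

/-- Convolution with an even kernel is symmetric for the bilinear pairing. -/
theorem integral_dot_conv_comm (hκ : Integrable κ) (hκe : ∀ x, κ (-x) = κ x) (hE : Integrable E)
    {V : Set R3} (hg : IsTestField V g) :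
    ∫ r, dot (conv κ E r) (g r) = ∫ r, dot (E r) (conv κ g r) := by
  obtain ⟨M, hM⟩ := hg.exists_norm_le
  have h0 : Integrable (fun p : R3 × R3 => κ (p.1 - p.2) • E p.2) (volume.prod volume) :=
    Integrable.convolution_integrand (ContinuousLinearMap.lsmul ℂ ℂ : ℂ →L[ℂ] C3 →L[ℂ] C3).flip
      hE hκ
  have h1 : Integrable (fun p : R3 × R3 => κ (p.1 - p.2) * dot (E p.2) (g p.1))
      (volume.prod volume) := by
    refine (h0.norm.const_mul M).mono' ?_ (Filter.Eventually.of_forall fun p => ?_)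
    · have := continuous_dot.comp_aestronglyMeasurable (h0.aestronglyMeasurable.prodMk
        (hg.1.continuous.comp continuous_fst).aestronglyMeasurable)
      simpa [smul_dot] using this
    · rw [← smul_dot, mul_comm]
      exact (norm_dot_le _ _).trans (mul_le_mul_of_nonneg_left (hM _) (norm_nonneg _))
  calc ∫ r, dot (conv κ E r) (g r) = ∫ r, ∫ t, κ (r - t) * dot (E t) (g r) := by
        refine integral_congr_ae ?_
        -- As `E` is merely integrable, the inner integral is only known to converge for almost
        -- every `r`.
        filter_upwards [h0.prod_right_ae] with r hr
        rw [dot_comm, conv_apply_swap, ← dotL_apply, ← ContinuousLinearMap.integral_comp_comm _ hr]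
        simp [dot_comm (g r)]
    _ = ∫ t, ∫ r, κ (r - t) * dot (E t) (g r) := integral_integral_swap h1
    _ = ∫ t, dot (E t) (conv κ g t) := by
        congr 1
        funext t
        rw [conv_apply_swap, ← dotL_apply, ← ContinuousLinearMap.integral_comp_comm _
          (integrable_conv_integrand_swap hκ hg t)]
        simp only [dotL_apply, dot_smul, ← neg_sub t, hκe]

theorem integral_dot_conv {V : Set R3} (hκ : Integrable κ) (hE : IsTestField V E)
    (hg : IsTestField V g) :
    ∫ r, dot (E r) (conv κ g r) = ∫ t, κ t * ∫ r, dot (E r) (g (r - t)) := by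
  obtain ⟨M, hM⟩ := hg.exists_norm_le
  have hc : Continuous fun p : R3 × R3 => dot (E p.1) (g (p.1 - p.2)) :=
    continuous_dot.comp ((hE.1.continuous.comp continuous_fst).prodMk
      (hg.1.continuous.comp (continuous_fst.sub continuous_snd)))
  have h0 : Integrable (fun p : R3 × R3 => κ p.2 * dot (E p.1) (g (p.1 - p.2)))
      (volume.prod volume) := by
    refine (((hE.integrable volume).norm.mul_prod hκ.norm).const_mul M).mono' ?_
      (Filter.Eventually.of_forall fun p => ?_)
    · exact hκ.aestronglyMeasurable.comp_snd.mul hc.aestronglyMeasurable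
    · rw [norm_mul]
      calc ‖κ p.2‖ * ‖dot (E p.1) (g (p.1 - p.2))‖ ≤ ‖κ p.2‖ * (‖E p.1‖ * M) := by
            gcongr
            exact (norm_dot_le _ _).trans (mul_le_mul_of_nonneg_left (hM _) (norm_nonneg _))
        _ = _ := by ring
  simp_rw [dot_conv hκ hg]
  rw [integral_integral_swap h0]
  simp_rw [integral_const_mul]

/-- Convolution commutes with the double curl. -/
theorem integral_dot_curl_curl_conv {V : Set R3} (hκ : Integrable κ) (hE : IsTestField V E)
    (hg : IsTestField V g) :
    ∫ r, dot (curl (curl E) r) (conv κ g r) = ∫ r, dot (E r) (conv κ (curl (curl g)) r) := by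
  rw [integral_dot_conv hκ hE.curl.curl hg, integral_dot_conv hκ hE hg.curl.curl]
  congr 1
  funext t
  congr 1
  have h1 : ContDiff ℝ ∞ fun r => g (r + -t) := hg.1.comp (contDiff_id.add contDiff_const)
  have h2 := integral_dot_curl_curl h1 hE.1 hE.2.1
  rw [curl_comp_add_right, curl_comp_add_right] at h2
  simp only [sub_eq_add_neg]
  rw [integral_congr_ae (Filter.Eventually.of_forall fun r => dot_comm _ _), h2]
  exact integral_congr_ae (Filter.Eventually.of_forall fun r => dot_comm _ _)

end Conv

/-! ### The potential as a convolution -/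

theorem truncatedKernel_neg (k D : ℝ) (x : R3) : truncatedKernel k D (-x) = truncatedKernel k D x := by
  simp [truncatedKernel, indicator, differenceKernel]

theorem exists_sub_mem_ball {V : Set R3} (hVb : Bornology.IsBounded V) :
    ∃ D : ℝ, 0 ≤ D ∧ ∀ r ∈ V, ∀ r' ∈ V, r - r' ∈ ball (0 : R3) D := by
  obtain ⟨R, hR⟩ := hVb.exists_norm_le
  -- The `+ 1` gives the strict inequality of an open ball. The absolute value covers an empty `V`,
  -- whose bound `R` may be negative.
  refine ⟨2 * |R| + 1, by positivity, fun r hr r' hr' => ?_⟩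
  rw [mem_ball_zero_iff]
  have := norm_sub_le r r'
  have := hR r hr
  have := hR r' hr'
  have := le_abs_self R
  linarith

/-- Both arguments of the kernel lie in `V`, so the cutoff is never felt. -/
theorem potential_eq_conv {V : Set R3} (hV : MeasurableSet V) {D : ℝ}
    (hD : ∀ r ∈ V, ∀ r' ∈ V, r - r' ∈ ball (0 : R3) D) (k : ℝ) (E : R3 → C3) {r : R3}
    (hr : r ∈ V) : potential k V E r = conv (truncatedKernel k D) (V.indicator E) r := by
  rw [potential, ← integral_indicator hV, conv_apply_swap]
  congr 1
  funext t
  by_cases ht : t ∈ V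
  · rw [indicator_of_mem ht, indicator_of_mem ht, helmholtzKernel_eq, truncatedKernel,
      indicator_of_mem (hD r hr t ht)]
  · rw [indicator_of_notMem ht, indicator_of_notMem ht, smul_zero]

theorem IsTestField.setIntegral_dot_left {V : Set R3} {g : R3 → C3} (hg : IsTestField V g)
    (F : R3 → C3) : ∫ r in V, dot (F r) (g r) = ∫ r, dot (F r) (g r) :=
  setIntegral_eq_integral_of_forall_compl_eq_zero fun r hr => by
    simp [hg.eq_zero_of_notMem hr, dot]

theorem IsTestField.setIntegral_dot_right {V : Set R3} {g : R3 → C3} (hg : IsTestField V g)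
    (F : R3 → C3) : ∫ r in V, dot (g r) (F r) = ∫ r, dot (g r) (F r) := by
  simp_rw [dot_comm (g _)]
  exact hg.setIntegral_dot_left F

/-- Moving the kernel to the smooth factor makes the right side continuous in `E` for the `L²` norm.
-/
theorem setIntegral_dot_potential {V : Set R3} (hV : MeasurableSet V) {D : ℝ}
    (hD : ∀ r ∈ V, ∀ r' ∈ V, r - r' ∈ ball (0 : R3) D) (k : ℝ) {E g : R3 → C3}
    (hE : IntegrableOn E V) (hg : IsTestField V g) :
    ∫ r in V, dot (potential k V E r) (g r) =
      ∫ r in V, dot (E r) (conv (truncatedKernel k D) g r) := by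
  calc ∫ r in V, dot (potential k V E r) (g r)
      = ∫ r in V, dot (conv (truncatedKernel k D) (V.indicator E) r) (g r) :=
        setIntegral_congr_fun hV fun r hr => by rw [potential_eq_conv hV hD k E hr]
    _ = ∫ r, dot (V.indicator E r) (conv (truncatedKernel k D) g r) := by
        rw [hg.setIntegral_dot_left, integral_dot_conv_comm (integrable_truncatedKernel k D)
          (truncatedKernel_neg k D) (hE.integrable_indicator hV) hg]
    _ = ∫ r in V, dot (E r) (conv (truncatedKernel k D) g r) := by
        rw [← integral_indicator hV]
        congr 1
        funext r
        by_cases hr : r ∈ V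
        · simp [hr]
        · simp [hr, dot]

/-- The double curl of the potential is a symmetric form on test fields. -/
theorem setIntegral_dot_conv_curl_curl {V : Set R3} {D k : ℝ} {a b : R3 → C3}
    (ha : IsTestField V a) (hb : IsTestField V b) :
    ∫ r in V, dot (conv (truncatedKernel k D) (curl (curl a)) r) (b r) =
      ∫ r in V, dot (a r) (conv (truncatedKernel k D) (curl (curl b)) r) := by
  rw [hb.setIntegral_dot_left, ha.setIntegral_dot_right,
    integral_dot_conv_comm (integrable_truncatedKernel k D) (truncatedKernel_neg k D)
      (ha.curl.curl.integrable _) hb,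
    integral_dot_curl_curl_conv (integrable_truncatedKernel k D) ha hb]

/-! ### Test fields in `L²(V; ℂ³)` -/

/-- The space of test fields. -/
def testFields (V : Set R3) : Submodule ℂ (R3 → C3) where
  carrier := {φ | IsTestField V φ}
  add_mem' {a b} ha hb := ⟨ha.1.add hb.1, ha.2.1.add hb.2.1,
    (tsupport_add a b).trans (union_subset ha.2.2 hb.2.2)⟩
  zero_mem' := ⟨contDiff_const, HasCompactSupport.zero, by simp [tsupport]⟩
  smul_mem' c a ha := by
    have hs : Function.support (c • a) ⊆ Function.support a :=
      Function.support_const_smul_subset c a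
    exact ⟨contDiff_const.smul ha.1, ha.2.1.mono hs, (closure_mono hs).trans ha.2.2⟩

theorem IsTestField.memLp {V : Set R3} {φ : R3 → C3} (hφ : IsTestField V φ) :
    MemLp φ 2 (volume.restrict V) :=
  hφ.1.continuous.memLp_of_hasCompactSupport hφ.2.1

/-- The embedding of test fields into `L²(V; ℂ³)`. -/
noncomputable def testToL2 (V : Set R3) : testFields V →ₗ[ℂ] L2 V where
  toFun φ := (IsTestField.memLp φ.2).toLp φ.1
  map_add' _ _ := MemLp.toLp_add _ _
  map_smul' _ _ := MemLp.toLp_const_smul _ _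

theorem coeFn_testToL2 {V : Set R3} (φ : testFields V) :
    testToL2 V φ =ᵐ[volume.restrict V] φ.1 :=
  MemLp.coeFn_toLp (IsTestField.memLp φ.2)

/-- Complex conjugation of test fields. -/
noncomputable def conjTest {V : Set R3} (φ : testFields V) : testFields V :=
  ⟨fun r => conjField (φ.1 r), IsTestField.conjField φ.2⟩

theorem conjField_conjField (v : C3) : conjField (conjField v) = v := by
  ext i; simp

theorem conjTest_conjTest {V : Set R3} (φ : testFields V) : conjTest (conjTest φ) = φ := by
  ext1; funext r; exact conjField_conjField _

theorem norm_testToL2 {V : Set R3} (φ : testFields V) :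
    ‖testToL2 V φ‖ = √(∫ r, ‖φ.1 r‖ ^ 2) := by
  have hφ : IsTestField V φ.1 := φ.2
  rw [← Real.sqrt_sq (norm_nonneg _), ← inner_self_eq_norm_sq (𝕜 := ℂ), L2.inner_def]
  congr 1
  rw [← setIntegral_eq_integral_of_forall_compl_eq_zero (s := V) (f := fun r => ‖φ.1 r‖ ^ 2)
    (fun r hr => by simp [hφ.eq_zero_of_notMem hr]), ← integral_re (L2.integrable_inner _ _)]
  refine integral_congr_ae ?_
  filter_upwards [coeFn_testToL2 φ] with r hr
  rw [hr, inner_self_eq_norm_sq]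

theorem norm_testToL2_conjTest {V : Set R3} (φ : testFields V) :
    ‖testToL2 V (conjTest φ)‖ = ‖testToL2 V φ‖ := by
  simp [norm_testToL2, conjTest, norm_conjField]

/-- Conjugating the test field translates between the Hermitian product of `L²` and the bilinear
pairing of the weak equation. -/
theorem inner_testToL2 {V : Set R3} (φ : testFields V) (x : L2 V) :
    inner ℂ (testToL2 V (conjTest φ)) x = ∫ r in V, dot (x r) (φ.1 r) := by
  rw [L2.inner_def]
  refine integral_congr_ae ?_
  filter_upwards [coeFn_testToL2 (conjTest φ)] with r hr
  rw [hr, inner_eq_dot, dot_comm]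
  simp [conjTest, conjField_conjField]

/-- A field orthogonal to all products of a scalar bump and a constant vector vanishes almost
everywhere on `V`, by the fundamental lemma of the calculus of variations. -/
theorem denseRange_testToL2 {V : Set R3} (hV : IsOpen V) : DenseRange (testToL2 V) := by
  have h : (LinearMap.range (testToL2 V)).topologicalClosure = ⊤ := by
    rw [Submodule.topologicalClosure_eq_top_iff, Submodule.eq_bot_iff]
    intro x hx
    have hx' (φ : testFields V) : ∫ r in V, dot (x r) (φ.1 r) = 0 := by
      rw [← inner_testToL2]
      exact hx _ (LinearMap.mem_range_self _ _)
    have hli : LocallyIntegrable x (volume.restrict V) :=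
      (Lp.memLp x).locallyIntegrable (by norm_num)
    have hz := hV.ae_eq_zero_of_integral_contDiff_smul_eq_zero (hli.locallyIntegrableOn V)
      (fun g hg hgc hgV => ?_)
    · refine (Lp.eq_zero_iff_ae_eq_zero).2 ?_
      filter_upwards [hz, ae_restrict_mem hV.measurableSet] with r hr hrV using hr hrV
    · refine ext_dot fun v => ?_
      have hs : Function.support (fun r => (g r : ℂ) • v) ⊆ Function.support g :=
        fun r hr (h0 : g r = 0) => hr (by simp [h0])
      have ht : IsTestField V fun r => (g r : ℂ) • v :=
        ⟨(Complex.ofRealCLM.contDiff.comp hg).smul contDiff_const, hgc.mono hs,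
          (closure_mono hs).trans hgV⟩
      have hint : Integrable (fun r => g r • x r) (volume.restrict V) :=
        hli.integrable_smul_left_of_hasCompactSupport hg.continuous hgc
      rw [← dotL_apply, ← ContinuousLinearMap.integral_comp_comm _ hint]
      have h0 := hx' ⟨_, ht⟩
      have hd0 : dot v 0 = 0 := by simp [dot]
      rw [hd0, ← h0]
      congr 1
      funext r
      rw [dotL_apply, dot_smul, dot_comm (x r), ← dot_smul]
      rfl
  rw [DenseRange, dense_iff_closure_eq, ← LinearMap.coe_range]
  simpa using congrArg (fun S : Submodule ℂ (L2 V) => (S : Set (L2 V))) h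

theorem eq_of_forall_setIntegral_dot {V : Set R3} (hV : IsOpen V) {x y : L2 V}
    (h : ∀ φ, IsTestField V φ → ∫ r in V, dot (x r) (φ r) = ∫ r in V, dot (y r) (φ r)) :
    x = y := by
  have hd : Dense (range (testToL2 V)) := denseRange_testToL2 hV
  refine hd.eq_of_inner_right (𝕜 := ℂ) ?_
  rintro _ ⟨φ, rfl⟩
  have := h _ (conjTest φ).2
  rwa [← inner_testToL2, ← inner_testToL2, conjTest_conjTest] at this

/-! ### The double curl of the potential as a bounded operator -/

theorem IsTestField.memLp_conv {V : Set R3} (hV : MeasurableSet V) (hVb : Bornology.IsBounded V) {g : R3 → C3}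
    (hg : IsTestField V g) (k D : ℝ) :
    MemLp (conv (truncatedKernel k D) g) 2 (volume.restrict V) := by
  have hc := hg.continuous_conv (integrable_truncatedKernel k D)
  have : IsFiniteMeasure (volume.restrict V) := ⟨by simpa using hVb.measure_lt_top⟩
  obtain ⟨M, hM⟩ := hVb.isCompact_closure.exists_bound_of_continuousOn hc.continuousOn
  exact MemLp.of_bound hc.aestronglyMeasurable M (ae_restrict_of_forall_mem hV
    fun r hr => hM r (subset_closure hr))

/-- The double curl of the potential of a test field. -/
noncomputable def curlCurlPotential {V : Set R3} (hV : IsOpen V) (hVb : Bornology.IsBounded V) (k D : ℝ) :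
    testFields V →ₗ[ℂ] L2 V where
  toFun φ := (IsTestField.memLp_conv hV.measurableSet hVb (IsTestField.curl (IsTestField.curl φ.2)) k D).toLp _
  map_add' a b := by
    rw [← MemLp.toLp_add]
    congr 1
    have ha : IsTestField V a.1 := a.2
    have hb : IsTestField V b.1 := b.2
    change conv _ (curl (curl (a.1 + b.1))) = _
    rw [curl_add (ha.1.differentiable (by simp)) (hb.1.differentiable (by simp)),
      curl_add (ha.curl.1.differentiable (by simp)) (hb.curl.1.differentiable (by simp)),
      ha.curl.curl.conv_add (integrable_truncatedKernel k D) hb.curl.curl]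
  map_smul' c a := by
    rw [RingHom.id_apply, ← MemLp.toLp_const_smul]
    congr 1
    have ha : IsTestField V a.1 := a.2
    change conv _ (curl (curl (c • a.1))) = _
    rw [curl_const_smul (ha.1.differentiable (by simp)),
      curl_const_smul (ha.curl.1.differentiable (by simp)), conv_const_smul]

theorem coeFn_curlCurlPotential {V : Set R3} (hV : IsOpen V) (hVb : Bornology.IsBounded V) (k D : ℝ)
    (φ : testFields V) : curlCurlPotential hV hVb k D φ =ᵐ[volume.restrict V]
      conv (truncatedKernel k D) (curl (curl φ.1)) :=
  MemLp.coeFn_toLp (IsTestField.memLp_conv hV.measurableSet hVb (IsTestField.curl (IsTestField.curl φ.2)) k D)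

theorem inner_curlCurlPotential {V : Set R3} (hV : IsOpen V) (hVb : Bornology.IsBounded V) {D k : ℝ}
    (a φ : testFields V) :
    inner ℂ (testToL2 V (conjTest a)) (curlCurlPotential hV hVb k D φ) =
      ∫ r in V, dot (conv (truncatedKernel k D) a.1 r) (curl (curl φ.1) r) := by
  have ha : IsTestField V a.1 := a.2
  have hφ : IsTestField V φ.1 := φ.2
  rw [inner_testToL2, hφ.curl.curl.setIntegral_dot_left,
    integral_dot_conv_comm (integrable_truncatedKernel k D) (truncatedKernel_neg k D)
      (ha.integrable _) hφ.curl.curl, ← ha.setIntegral_dot_right]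
  refine integral_congr_ae ?_
  filter_upwards [coeFn_curlCurlPotential hV hVb k D φ] with r hr
  rw [hr, dot_comm]

/-- By duality: the Fourier estimate bounds the product with every test field, hence by density with
every `x`, and in particular with the vector itself. -/
theorem norm_curlCurlPotential_le {V : Set R3} (hV : IsOpen V) (hVb : Bornology.IsBounded V)
    {D : ℝ} (hD : 0 ≤ D) (k : ℝ) (φ : testFields V) :
    ‖curlCurlPotential hV hVb k D φ‖ ≤ (2 + |k| * D) * ‖testToL2 V φ‖ := by
  set C := (2 + |k| * D) * ‖testToL2 V φ‖ with hC
  have hb (x : L2 V) : ‖inner ℂ x (curlCurlPotential hV hVb k D φ)‖ ≤ C * ‖x‖ := by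
    refine (denseRange_testToL2 hV).induction_on x
      (isClosed_le (by fun_prop) (by fun_prop)) fun a => ?_
    rw [← conjTest_conjTest a, inner_curlCurlPotential, norm_testToL2_conjTest, hC,
      norm_testToL2, norm_testToL2]
    have ha : IsTestField V (conjTest a).1 := (conjTest a).2
    have hφ : IsTestField V φ.1 := φ.2
    rw [hφ.curl.curl.setIntegral_dot_left, mul_assoc, mul_comm (√_)]
    exact norm_integral_dot_convolution_le k hD ha hφ
  have h := hb (curlCurlPotential hV hVb k D φ)
  rw [inner_self_eq_norm_sq_to_K] at h
  rcases eq_or_lt_of_le (norm_nonneg (curlCurlPotential hV hVb k D φ)) with h0 | h0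
  · rw [← h0]; positivity
  · refine le_of_mul_le_mul_right ?_ h0
    simpa [pow_two] using h

/-- The operator `E ↦ ∇ × ∇ × C E` on `L²(V; ℂ³)`. -/
noncomputable def curlCurlOp {V : Set R3} (hV : IsOpen V) (hVb : Bornology.IsBounded V) (k D : ℝ) :
    L2 V →L[ℂ] L2 V := (curlCurlPotential hV hVb k D).extendOfNorm (testToL2 V)

theorem curlCurlOp_testToL2 {V : Set R3} (hV : IsOpen V) (hVb : Bornology.IsBounded V) {D : ℝ}
    (hD0 : 0 ≤ D) (k : ℝ) (φ : testFields V) :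
    curlCurlOp hV hVb k D (testToL2 V φ) = curlCurlPotential hV hVb k D φ :=
  LinearMap.extendOfNorm_eq (denseRange_testToL2 hV)
    ⟨_, norm_curlCurlPotential_le hV hVb hD0 k⟩ φ

theorem continuous_setIntegral_dot {V : Set R3} {g : R3 → C3} (hg : MemLp g 2 (volume.restrict V)) :
    Continuous fun x : L2 V => ∫ r in V, dot (x r) (g r) := by
  have hg' : MemLp (fun r => conjField (g r)) 2 (volume.restrict V) := conjL.comp_memLp' hg
  have h (x : L2 V) : ∫ r in V, dot (x r) (g r) = inner ℂ (hg'.toLp _) x := by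
    rw [L2.inner_def]
    refine integral_congr_ae ?_
    filter_upwards [hg'.coeFn_toLp] with r hr
    rw [hr, inner_eq_dot, dot_comm, conjField_conjField]
  simp_rw [h]
  fun_prop

theorem L2.integrableOn {V : Set R3} (hVb : Bornology.IsBounded V) (x : L2 V) :
    IntegrableOn x V := by
  have : IsFiniteMeasure (volume.restrict V) := ⟨by simpa using hVb.measure_lt_top⟩
  exact (Lp.memLp x).integrable (by norm_num)

/-- Once the kernel sits on `φ`, both sides are continuous in `E`. For a test field in place of `E`,
the equation is the symmetry `setIntegral_dot_conv_curl_curl`. -/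
theorem hasWeakCurlCurl_curlCurlOp {V : Set R3} (hV : IsOpen V) (hVb : Bornology.IsBounded V)
    {D : ℝ} (hD0 : 0 ≤ D) (hD : ∀ r ∈ V, ∀ r' ∈ V, r - r' ∈ ball (0 : R3) D) (k : ℝ)
    (E : L2 V) : HasWeakCurlCurl V (potential k V E) (curlCurlOp hV hVb k D E) := by
  intro φ hφ
  rw [setIntegral_dot_potential hV.measurableSet hD k (L2.integrableOn hVb E) hφ.curl.curl]
  refine (denseRange_testToL2 hV).induction_on E (isClosed_eq
    ((continuous_setIntegral_dot hφ.memLp).comp (curlCurlOp hV hVb k D).continuous)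
    (continuous_setIntegral_dot (hφ.curl.curl.memLp_conv hV.measurableSet hVb k D))) fun a => ?_
  rw [curlCurlOp_testToL2 hV hVb hD0]
  calc _ = ∫ r in V, dot (conv (truncatedKernel k D) (curl (curl a.1)) r) (φ r) := by
        refine integral_congr_ae ?_
        filter_upwards [coeFn_curlCurlPotential hV hVb k D a] with r hr
        rw [hr]
    _ = ∫ r in V, dot (a.1 r) (conv (truncatedKernel k D) (curl (curl φ)) r) :=
        setIntegral_dot_conv_curl_curl a.2 hφ
    _ = _ := by
        refine integral_congr_ae ?_
        filter_upwards [coeFn_testToL2 a] with r hr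
        rw [hr]

/-! ### Continuity of the far field -/

theorem continuous_cross : Continuous fun p : R3 × C3 => cross p.1 p.2 := by
  have h (p : R3 × C3) : cross p.1 p.2 = !₂[(p.1 1 : ℂ) * p.2 2 - p.1 2 * p.2 1,
      (p.1 2 : ℂ) * p.2 0 - p.1 0 * p.2 2, (p.1 0 : ℂ) * p.2 1 - p.1 1 * p.2 0] := by
    ext i
    fin_cases i
    · exact cross_apply_zero _ _
    · exact cross_apply_one _ _
    · exact cross_apply_two _ _
  simp_rw [h]
  refine (PiLp.continuous_toLp 2 _).comp (continuous_pi fun i => ?_)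
  fin_cases i <;> simp <;> fun_prop

theorem cross_smul_left (c : ℝ) (n : R3) (v : C3) : cross (c • n) v = (c : ℂ) • cross n v := by
  ext i
  fin_cases i <;> simp [cross, crossProduct] <;> ring

theorem norm_exp_smul (q r : R3) (v : C3) :
    ‖Complex.exp (Complex.I * (inner ℝ q r : ℝ)) • v‖ = ‖v‖ := by
  rw [norm_smul, mul_comm Complex.I, Complex.norm_exp_ofReal_mul_I, one_mul]

theorem norm_fourier_le (V : Set R3) (E : R3 → C3) (q : R3) :
    ‖fourier V E q‖ ≤ ∫ r in V, ‖E r‖ := by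
  refine (norm_integral_le_integral_norm _).trans_eq ?_
  simp_rw [norm_exp_smul]

theorem continuous_fourier {V : Set R3} {E : R3 → C3} (hE : IntegrableOn E V) :
    Continuous (fourier V E) := by
  refine continuous_of_dominated (bound := fun r => ‖E r‖)
    (fun q => (integrable_exp_smul hE q).aestronglyMeasurable)
    (fun q => Filter.Eventually.of_forall fun r => (norm_exp_smul q r _).le) hE.norm
    (Filter.Eventually.of_forall fun r => ?_)
  fun_prop

theorem continuous_fourier_sphere {V : Set R3} {E : R3 → C3} (k : ℝ) (hE : IntegrableOn E V) :
    Continuous fun n : sphere (0 : R3) 1 => fourier V E (k • (n : R3)) :=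
  (continuous_fourier hE).comp (g := fourier V E) (f := fun n : sphere (0 : R3) 1 => k • (n : R3))
    (by fun_prop)

theorem continuous_farField {V : Set R3} {E : R3 → C3} (k : ℝ) (hE : IntegrableOn E V) :
    Continuous fun n : sphere (0 : R3) 1 =>
      ‖cross (n : R3) (fourier V E (k • (n : R3)))‖ ^ 2 := by
  have h : Continuous fun n : sphere (0 : R3) 1 => ((n : R3), fourier V E (k • (n : R3))) :=
    continuous_subtype_val.prodMk (continuous_fourier_sphere k hE)
  exact (continuous_cross.comp h).norm.pow 2

theorem fourier_congr_ae {V : Set R3} {E F : R3 → C3} (h : E =ᵐ[volume.restrict V] F) (q : R3) :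
    fourier V E q = fourier V F q := by
  refine integral_congr_ae ?_
  filter_upwards [h] with r hr
  rw [hr]

theorem continuous_fourier_L2 {V : Set R3} (hVb : Bornology.IsBounded V) (q : R3) :
    Continuous fun E : L2 V => fourier V E q := by
  have : IsFiniteMeasure (volume.restrict V) := ⟨by simpa using hVb.measure_lt_top⟩
  have h (E : L2 V) (i : Fin 3) : fourier V E q i =
      ∫ r in V, dot (E r) (planeWave q (EuclideanSpace.single i 1) r) := by
    have h1 : fourier V E q i = dotL (EuclideanSpace.single i 1) (fourier V E q) := by
      simp [dot]
    rw [h1, fourier, ← ContinuousLinearMap.integral_comp_comm _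
      (integrable_exp_smul (L2.integrableOn hVb E) q)]
    simp only [dotL_apply, planeWave, dot_smul, smul_dot, dot_comm]
  have hc : Continuous fun E : L2 V => (fourier V E q).ofLp := by
    refine continuous_pi fun i => ?_
    simp_rw [h]
    refine continuous_setIntegral_dot (MemLp.of_bound
      (contDiff_planeWave q _).continuous.aestronglyMeasurable 1
      (Filter.Eventually.of_forall fun r => ?_))
    rw [planeWave, norm_exp_smul]
    simp
  exact (PiLp.continuous_toLp 2 _).comp hc

/-- From `t ≤ 1 + t²`. A crude bound is enough, as it only has to dominate the far field uniformly
for `E` in a ball. -/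
theorem integral_norm_le_L2 {V : Set R3} (hVb : Bornology.IsBounded V) (E : L2 V) :
    ∫ r in V, ‖E r‖ ≤ volume.real V + ‖E‖ ^ 2 := by
  have : IsFiniteMeasure (volume.restrict V) := ⟨by simpa using hVb.measure_lt_top⟩
  have hi : Integrable (fun r => ‖E r‖ ^ 2) (volume.restrict V) := (Lp.memLp E).integrable_norm_pow (by simp)
  have hn : ‖E‖ ^ 2 = ∫ r in V, ‖E r‖ ^ 2 := by
    rw [← inner_self_eq_norm_sq (𝕜 := ℂ), L2.inner_def, ← integral_re (L2.integrable_inner _ _)]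
    simp_rw [inner_self_eq_norm_sq]
  have h1 : volume.real V = ∫ r in V, (1 : ℝ) := by simp
  rw [hn, h1, ← integral_add (integrable_const _) hi]
  refine integral_mono (L2.integrableOn hVb E).norm ((integrable_const _).add hi) fun r => ?_
  simp only
  nlinarith [sq_nonneg (‖E r‖ - 1)]

/-- Dominated convergence on the sphere, with a constant bound valid while `‖E‖ < ‖E₀‖ + 1`. This
carries the optical identity from test fields to all of `L²`. -/
theorem continuous_sphereIntegral {V : Set R3} (hVb : Bornology.IsBounded V) (k : ℝ) :
    Continuous fun E : L2 V => sphereIntegral k V E := by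
  refine continuous_iff_continuousAt.2 fun E₀ => ?_
  unfold sphereIntegral
  refine continuousAt_of_dominated (μ := (volume : Measure R3).toSphere)
    (F := fun (E : L2 V) (n : sphere (0 : R3) 1) =>
      ‖cross (n : R3) (fourier V E (k • (n : R3)))‖ ^ 2)
    (bound := fun _ => (volume.real V + (‖E₀‖ + 1) ^ 2) ^ 2) ?_ ?_ (integrable_const _) ?_
  · exact Filter.Eventually.of_forall fun E =>
      (continuous_farField k (L2.integrableOn hVb E)).aestronglyMeasurable
  · have hE : ∀ᶠ E : L2 V in nhds E₀, ‖E‖ < ‖E₀‖ + 1 :=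
      continuous_norm.continuousAt.eventually_lt_const (lt_add_one _)
    filter_upwards [hE] with E hE
    refine Filter.Eventually.of_forall fun n => ?_
    rw [norm_pow, norm_norm]
    gcongr
    refine (norm_cross_le _ _).trans ?_
    rw [norm_eq_of_mem_sphere, one_mul]
    refine (norm_fourier_le _ _ _).trans ((integral_norm_le_L2 hVb E).trans ?_)
    gcongr
  · refine Filter.Eventually.of_forall fun n => Continuous.continuousAt ?_
    have h := continuous_fourier_L2 hVb (k • (n : R3))
    have h2 : Continuous fun v : C3 => cross (n : R3) v :=
      continuous_cross.comp (Continuous.prodMk_right (n : R3))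
    exact (h2.comp h).norm.pow 2

/-! ### The imaginary part of the Helmholtz kernel -/

/-- Both sides equal `2i sin(k|x|) / (4π|x|)`. The plane waves on the right separate the variables
in `x = t - r`. -/
theorem conj_differenceKernel_sub {k : ℝ} (hk : 0 < k) {x : R3} (hx : x ≠ 0) :
    conj (differenceKernel k x) - differenceKernel k x =
      (2 * Complex.I * (k / (16 * Real.pi ^ 2))) * ∫ n : sphere (0 : R3) 1,
        Complex.exp (Complex.I * (inner ℝ (k • (n : R3)) x : ℝ)) ∂(volume : Measure R3).toSphere := by
  have h := integral_sphere_exp (q := k • x) (smul_ne_zero hk.ne' hx)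
  simp_rw [real_inner_smul_left, real_inner_comm _ x, ← real_inner_smul_left] at h
  rw [h, norm_smul, Real.norm_of_nonneg hk.le, differenceKernel]
  have h1 : (‖x‖ : ℂ) ≠ 0 := by exact_mod_cast (norm_pos_iff.2 hx).ne'
  have h2 : (Real.pi : ℂ) ≠ 0 := by exact_mod_cast Real.pi_ne_zero
  have h3 : (k : ℂ) ≠ 0 := by exact_mod_cast hk.ne'
  have e1 : Complex.exp (-(Complex.I * k * ‖x‖)) = Complex.cos (k * ‖x‖) -
      Complex.sin (k * ‖x‖) * Complex.I := by
    have : -(Complex.I * k * ‖x‖) = (-(k * ‖x‖ : ℂ)) * Complex.I := by ring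
    rw [this, Complex.exp_mul_I]
    simp [sub_eq_add_neg]
  rw [map_div₀, ← Complex.exp_conj]
  have e2 : Complex.exp (conj (-(Complex.I * k * ‖x‖))) = Complex.cos (k * ‖x‖) +
      Complex.sin (k * ‖x‖) * Complex.I := by
    rw [← Complex.exp_mul_I]
    congr 1
    simp
    ring
  rw [e1, e2]
  simp only [map_mul, Complex.conj_ofReal, map_ofNat]
  push_cast
  field_simp
  ring

/-! ### The optical theorem for test fields -/

/-- Conjugating the field before and after the convolution conjugates only the kernel, so `conj κ -
κ` acts on `ψ`. Its plane wave expansion and Fubini produce the far field of `ψ`. -/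
theorem integral_conj_conv_sub {V : Set R3} (hVb : Bornology.IsBounded V) (hV : MeasurableSet V)
    {D k : ℝ} (hk : 0 < k) (hD : ∀ r ∈ V, ∀ r' ∈ V, r - r' ∈ ball (0 : R3) D) {ψ : R3 → C3}
    (hψ : IsTestField V ψ) {r : R3} (hr : r ∈ V) :
    conjField (conv (truncatedKernel k D) (fun t => conjField (ψ t)) r) -
        conv (truncatedKernel k D) ψ r =
      (2 * Complex.I * (k / (16 * Real.pi ^ 2))) • ∫ n : sphere (0 : R3) 1,
        Complex.exp (-(Complex.I * (inner ℝ (k • (n : R3)) r : ℝ))) •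
          fourier V ψ (k • (n : R3)) ∂(volume : Measure R3).toSphere := by
  have : IsFiniteMeasure (volume.restrict V) := ⟨by simpa using hVb.measure_lt_top⟩
  have hκ := integrable_truncatedKernel k D
  have h1 : conjField (conv (truncatedKernel k D) (fun t => conjField (ψ t)) r) =
      ∫ t, conj (truncatedKernel k D (r - t)) • ψ t := by
    rw [conv_apply_swap, ← conjL_apply, ← ContinuousLinearMap.integral_comp_comm _
      (integrable_conv_integrand_swap hκ hψ.conjField r)]
    congr 1
    funext t
    ext i
    simp [conjL_apply]
  have hi1 : Integrable fun t => conj (truncatedKernel k D (r - t)) • ψ t := by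
    have := conjL.integrable_comp (integrable_conv_integrand_swap hκ hψ.conjField r)
    refine this.congr (Filter.Eventually.of_forall fun t => ?_)
    ext i
    simp [conjL_apply]
  have hF : Integrable (fun p : R3 × sphere (0 : R3) 1 =>
      Complex.exp (Complex.I * (inner ℝ (k • (p.2 : R3)) (p.1 - r) : ℝ)) • ψ p.1)
      ((volume.restrict V).prod (volume : Measure R3).toSphere) := by
    have hc : Continuous fun p : R3 × sphere (0 : R3) 1 =>
      Complex.exp (Complex.I * (inner ℝ (k • (p.2 : R3)) (p.1 - r) : ℝ)) := by fun_prop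
    refine Integrable.bdd_smul ((hψ.integrable (volume.restrict V)).comp_fst _) 1
      hc.aestronglyMeasurable (Filter.Eventually.of_forall fun p => ?_)
    rw [mul_comm Complex.I, Complex.norm_exp_ofReal_mul_I]
  rw [h1, conv_apply_swap, ← integral_sub hi1 (integrable_conv_integrand_swap hκ hψ r),
    ← setIntegral_eq_integral_of_forall_compl_eq_zero (s := V)
      (fun t ht => by simp [hψ.eq_zero_of_notMem ht])]
  calc _ = ∫ t in V, (2 * Complex.I * (k / (16 * Real.pi ^ 2))) • ∫ n : sphere (0 : R3) 1,
        Complex.exp (Complex.I * (inner ℝ (k • (n : R3)) (t - r) : ℝ)) • ψ t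
          ∂(volume : Measure R3).toSphere := by
        refine integral_congr_ae ?_
        -- The kernel identity needs `t ≠ r`, which excludes a null set.
        have hne : ∀ᵐ t ∂(volume.restrict V), t ≠ r :=
          ae_restrict_of_ae (Measure.ae_ne volume r)
        filter_upwards [hne, ae_restrict_mem hV] with t htr htV
        rw [← sub_smul, integral_smul_const, smul_smul,
          ← conj_differenceKernel_sub hk (sub_ne_zero.2 htr), ← neg_sub t r, truncatedKernel_neg,
          truncatedKernel, indicator_of_mem (hD t htV r hr)]
    _ = _ := by
        rw [integral_smul, integral_integral_swap hF]
        congr 2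
        funext n
        rw [fourier, ← integral_smul]
        congr 1
        funext t
        rw [smul_smul, ← Complex.exp_add, inner_sub_right]
        congr 2
        push_cast
        ring

/-- Integrating the outgoing phases `e^{-ikn·r}` against `conj φ` gives the conjugate far field of
`φ`. Fubini applies since the far field of `ψ` is bounded by its `L¹` norm. -/
theorem setIntegral_dot_conj_conv_sub {V : Set R3} (hVb : Bornology.IsBounded V)
    (hV : MeasurableSet V) {D k : ℝ} (hk : 0 < k)
    (hD : ∀ r ∈ V, ∀ r' ∈ V, r - r' ∈ ball (0 : R3) D) {φ ψ : R3 → C3}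
    (hφ : IsTestField V φ) (hψ : IsTestField V ψ) :
    ∫ r in V, dot (conjField (φ r))
      (conjField (conv (truncatedKernel k D) (fun t => conjField (ψ t)) r) -
        conv (truncatedKernel k D) ψ r) =
      (2 * Complex.I * (k / (16 * Real.pi ^ 2))) * ∫ n : sphere (0 : R3) 1,
        inner ℂ (fourier V φ (k • (n : R3))) (fourier V ψ (k • (n : R3)))
          ∂(volume : Measure R3).toSphere := by
  have : IsFiniteMeasure (volume.restrict V) := ⟨by simpa using hVb.measure_lt_top⟩
  have hψi := hψ.integrable (volume.restrict V)
  have hφi := hφ.integrable (volume.restrict V)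
  have hcψ := continuous_fourier_sphere k hψi
  have hce (r : R3) : Continuous fun n : sphere (0 : R3) 1 =>
      Complex.exp (-(Complex.I * (inner ℝ (k • (n : R3)) r : ℝ))) := by fun_prop
  have hne (n : sphere (0 : R3) 1) (r : R3) :
      ‖Complex.exp (-(Complex.I * (inner ℝ (k • (n : R3)) r : ℝ)))‖ = 1 := by
    rw [← mul_neg, ← Complex.ofReal_neg, mul_comm, Complex.norm_exp_ofReal_mul_I]
  have hF : Integrable (fun p : R3 × sphere (0 : R3) 1 =>
      Complex.exp (-(Complex.I * (inner ℝ (k • (p.2 : R3)) p.1 : ℝ))) *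
        dot (conjField (φ p.1)) (fourier V ψ (k • (p.2 : R3))))
      ((volume.restrict V).prod (volume : Measure R3).toSphere) := by
    refine ((hφi.norm.comp_fst (volume : Measure R3).toSphere).mul_const
      (∫ r in V, ‖ψ r‖)).mono' ?_ (Filter.Eventually.of_forall fun p => ?_)
    · have hc : Continuous fun p : R3 × sphere (0 : R3) 1 =>
        Complex.exp (-(Complex.I * (inner ℝ (k • (p.2 : R3)) p.1 : ℝ))) := by fun_prop
      have hd : Continuous fun p : R3 × sphere (0 : R3) 1 =>
          dot (conjField (φ p.1)) (fourier V ψ (k • (p.2 : R3))) :=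
        continuous_dot.comp ((hφ.conjField.1.continuous.comp continuous_fst).prodMk
          (hcψ.comp continuous_snd))
      exact (hc.mul hd).aestronglyMeasurable
    · rw [norm_mul, hne, one_mul]
      refine (norm_dot_le _ _).trans ?_
      rw [norm_conjField]
      exact mul_le_mul_of_nonneg_left (norm_fourier_le _ _ _) (norm_nonneg _)
  calc _ = ∫ r in V, (2 * Complex.I * (k / (16 * Real.pi ^ 2))) * ∫ n : sphere (0 : R3) 1,
        Complex.exp (-(Complex.I * (inner ℝ (k • (n : R3)) r : ℝ))) *
          dot (conjField (φ r)) (fourier V ψ (k • (n : R3))) ∂(volume : Measure R3).toSphere := by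
        refine setIntegral_congr_fun hV fun r hr => ?_
        have hi : Integrable (fun n : sphere (0 : R3) 1 =>
            Complex.exp (-(Complex.I * (inner ℝ (k • (n : R3)) r : ℝ))) •
              fourier V ψ (k • (n : R3))) (volume : Measure R3).toSphere :=
          Integrable.of_bound ((hce r).smul hcψ).aestronglyMeasurable (∫ r in V, ‖ψ r‖)
            (Filter.Eventually.of_forall fun n => by
              rw [norm_smul, hne, one_mul]; exact norm_fourier_le _ _ _)
        beta_reduce
        rw [integral_conj_conv_sub hVb hV hk hD hψ hr, dot_smul, ← dotL_apply,
          ← ContinuousLinearMap.integral_comp_comm _ hi]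
        simp
    _ = _ := by
        rw [integral_const_mul, integral_integral_swap hF]
        congr 2
        funext n
        generalize fourier V ψ (k • (n : R3)) = w
        rw [inner_eq_dot, dot_comm, ← dotL_apply, fourier, ← conjL_apply,
          ← ContinuousLinearMap.integral_comp_comm _ (integrable_exp_smul hφi _),
          ← ContinuousLinearMap.integral_comp_comm _
            (conjL.integrable_comp (integrable_exp_smul hφi _))]
        congr 1
        funext r
        have : conjL (Complex.exp (Complex.I * (inner ℝ (k • (n : R3)) r : ℝ)) • φ r) =
            Complex.exp (-(Complex.I * (inner ℝ (k • (n : R3)) r : ℝ))) • conjField (φ r) := by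
          ext i
          simp [conjL_apply, ← Complex.exp_conj]
        rw [this, dotL_apply, dot_smul, dot_comm]

theorem im_inner_curlCurlPotential {V : Set R3} (hV : IsOpen V) (hVb : Bornology.IsBounded V)
    {D k : ℝ} (hk : 0 < k) (hD : ∀ r ∈ V, ∀ r' ∈ V, r - r' ∈ ball (0 : R3) D)
    (φ : testFields V) :
    (inner ℂ (curlCurlPotential hV hVb k D φ) (testToL2 V φ)).im =
      k ^ 3 / (16 * Real.pi ^ 2) * sphereIntegral k V (testToL2 V φ) := by
  have hφ : IsTestField V φ.1 := φ.2
  have hφc := hφ.conjField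
  have hψ : IsTestField V (curl (curl φ.1)) := hφ.curl.curl
  set κ := truncatedKernel k D with hκ
  have hψc : curl (curl fun r => conjField (φ.1 r)) = fun r => conjField (curl (curl φ.1) r) := by
    rw [curl_conjField (hφ.1.differentiable (by simp)),
      curl_conjField (hφ.curl.1.differentiable (by simp))]
  set Z : ℂ := ∫ r in V, dot (conjField (φ.1 r)) (conv κ (curl (curl φ.1)) r) with hZ
  have hZ1 : inner ℂ (curlCurlPotential hV hVb k D φ) (testToL2 V φ) = conj Z := by
    rw [← inner_conj_symm, L2.inner_def]
    congr 1
    refine integral_congr_ae ?_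
    filter_upwards [coeFn_curlCurlPotential hV hVb k D φ, coeFn_testToL2 φ] with r h1 h2
    rw [h1, h2, inner_eq_dot]
  -- The symmetry of the form exchanges `φ` and its conjugate, so `conj Z` is `Z` with the kernel
  -- conjugated.
  have hZ2 : conj Z = ∫ r in V, dot (conjField (φ.1 r))
      (conjField (conv κ (fun t => conjField (curl (curl φ.1) t)) r)) := by
    rw [hZ, ← setIntegral_dot_conv_curl_curl hφc hφ, ← integral_conj, hψc]
    congr 1
    funext r
    rw [conj_dot, dot_comm]
  have hint {g : R3 → C3} (hg : Continuous g) :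
      Integrable (fun r => dot (conjField (φ.1 r)) (g r)) (volume.restrict V) := by
    refine (continuous_dot.comp (hφc.1.continuous.prodMk hg)).integrable_of_hasCompactSupport
      (hφc.2.1.mono fun r hr h0 => hr ?_)
    simp only [Function.comp] at h0 ⊢
    simp [h0, dot]
  have hdiff : conj Z - Z = ((2 * (k ^ 3 / (16 * Real.pi ^ 2) *
      sphereIntegral k V (testToL2 V φ)) : ℝ) : ℂ) * Complex.I := by
    have hc1 : Continuous fun r =>
        conjField (conv κ (fun t => conjField (curl (curl φ.1) t)) r) :=
      conjL.continuous.comp (hψ.conjField.continuous_conv (integrable_truncatedKernel k D))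
    rw [hZ2, hZ, ← integral_sub (hint hc1)
      (hint (hψ.continuous_conv (integrable_truncatedKernel k D)))]
    have h := setIntegral_dot_conj_conv_sub hVb hV.measurableSet hk hD hφ hψ
    simp only [← dotL_apply, map_sub] at h
    simp only [dotL_apply] at h
    rw [h]
    -- At `q = kn` the symbol `-q × (q × ·)` contributes `k²`. With the `k` of the kernel identity
    -- this makes `k³`.
    have hs (n : sphere (0 : R3) 1) : inner ℂ (fourier V φ.1 (k • (n : R3)))
        (fourier V (curl (curl φ.1)) (k • (n : R3))) =
        ((k ^ 2 * ‖cross (n : R3) (fourier V (testToL2 V φ) (k • (n : R3)))‖ ^ 2 : ℝ) : ℂ) := by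
      rw [hφ.fourier_curl_curl, ← inner_conj_symm, ← norm_sq_cross, Complex.conj_ofReal,
        cross_smul_left, norm_smul, fourier_congr_ae (coeFn_testToL2 φ), Complex.norm_real,
        mul_pow, Real.norm_eq_abs, sq_abs]
    simp_rw [hs]
    rw [integral_complex_ofReal, integral_const_mul, ← sphereIntegral]
    push_cast
    ring
  rw [hZ1]
  have him := congrArg Complex.im hdiff
  simp only [Complex.sub_im, Complex.conj_im, Complex.im_ofReal_mul, Complex.I_im] at him
  rw [Complex.conj_im]
  linarith

theorem im_inner_curlCurlOp {V : Set R3} (hV : IsOpen V) (hVb : Bornology.IsBounded V)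
    {D k : ℝ} (hD0 : 0 ≤ D) (hk : 0 < k)
    (hD : ∀ r ∈ V, ∀ r' ∈ V, r - r' ∈ ball (0 : R3) D) (E : L2 V) :
    (inner ℂ (curlCurlOp hV hVb k D E) E).im =
      k ^ 3 / (16 * Real.pi ^ 2) * sphereIntegral k V E := by
  refine (denseRange_testToL2 hV).induction_on E (isClosed_eq ?_ ?_) fun φ => ?_
  · exact Complex.continuous_im.comp ((curlCurlOp hV hVb k D).continuous.inner continuous_id)
  · exact continuous_const.mul (continuous_sphereIntegral hVb k)
  · rw [curlCurlOp_testToL2 hV hVb hD0]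
    exact im_inner_curlCurlPotential hV hVb hk hD φ

/-! ### Uniqueness of the weak double curl -/

theorem HasWeakCurlCurl.unique {V : Set R3} (hV : IsOpen V) {A : R3 → C3} {W W' : L2 V}
    (h : HasWeakCurlCurl V A W) (h' : HasWeakCurlCurl V A W') : W = W' :=
  eq_of_forall_setIntegral_dot hV fun φ hφ => (h φ hφ).trans (h' φ hφ).symm

end BornScattering

open BornScattering
/-- Generalized optical theorem. The operators exist and are unique on every bounded open set;
`B E` plays the role of the incident field in the energy balance. -/
theorem mainTheorem3 (V : Set R3) (hVo : IsOpen V) (hVb : Bornology.IsBounded V)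
    (k : ℝ) (hk : 0 < k) (χ : ℂ) :
    (∃! G : L2 V →L[ℂ] L2 V, IsGreenOperator k V G) ∧
    (∃! B : L2 V →L[ℂ] L2 V, IsBornOperator k χ V B) ∧
    ∀ G B : L2 V →L[ℂ] L2 V, IsGreenOperator k V G → IsBornOperator k χ V B →
      B = ContinuousLinearMap.id ℂ (L2 V) - χ • G ∧
      ∀ E : L2 V,
        (‖χ‖ ^ 2 * k ^ 5 / (16 * Real.pi ^ 2) * sphereIntegral k V E
          = (χ * k ^ 2 * ((∫ r in V, ‖E r‖ ^ 2 : ℝ) : ℂ)).im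
            - (χ * k ^ 2 * ∫ r in V, inner ℂ ((B E : L2 V) r) (E r)).im) ∧
        ((inner ℂ (E - B E) ((χ * (k : ℂ) ^ 2) • E)).im
          = ‖χ‖ ^ 2 * k ^ 5 / (16 * Real.pi ^ 2) * sphereIntegral k V E) ∧
        (scatteringCrossSection k χ V E + absorptionCrossSection k χ V E
          = 4 * Real.pi / k *
            (-(χ * k ^ 2 / (4 * Real.pi)) * ∫ r in V, inner ℂ ((B E : L2 V) r) (E r)).im) ∧
        (inner ℂ (G E) E).im = k ^ 3 / (16 * Real.pi ^ 2) * sphereIntegral k V E := by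
  obtain ⟨D, hD0, hD⟩ := exists_sub_mem_ball hVb
  set T := curlCurlOp hVo hVb k D with hT
  have hW := hasWeakCurlCurl_curlCurlOp hVo hVb hD0 hD k
  -- Uniqueness of the weak double curl forces `W = T E`, which settles uniqueness here and for `B`
  -- below.
  have hG : ∀ G : L2 V →L[ℂ] L2 V, IsGreenOperator k V G →
      G = T - ContinuousLinearMap.id ℂ (L2 V) := by
    intro G hG
    ext1 E
    obtain ⟨W, hWE, hGE⟩ := hG E
    rw [hGE, hWE.unique hVo (hW E)]
    rfl
  have hB : ∀ B : L2 V →L[ℂ] L2 V, IsBornOperator k χ V B →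
      B = (1 + χ) • ContinuousLinearMap.id ℂ (L2 V) - χ • T := by
    intro B hB
    ext1 E
    obtain ⟨W, hWE, hBE⟩ := hB E
    rw [hBE, hWE.unique hVo (hW E)]
    rfl
  refine ⟨⟨_, fun E => ⟨T E, hW E, rfl⟩, hG⟩, ⟨_, fun E => ⟨T E, hW E, rfl⟩, hB⟩, ?_⟩
  intro G B hG' hB'
  have hBG : B = ContinuousLinearMap.id ℂ (L2 V) - χ • G := by
    rw [hG G hG', hB B hB']
    module
  refine ⟨hBG, fun E => ?_⟩
  have hreal : inner ℂ E E = ((∫ r in V, ‖E r‖ ^ 2 : ℝ) : ℂ) := by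
    rw [L2.inner_def, ← integral_complex_ofReal]
    congr 1
    funext r
    rw [inner_self_eq_norm_sq_to_K]
    push_cast
    rfl
  have hGim : (inner ℂ (G E) E).im = k ^ 3 / (16 * Real.pi ^ 2) * sphereIntegral k V E := by
    rw [← im_inner_curlCurlOp hVo hVb hD0 hk hD E, hG G hG']
    rw [sub_apply, inner_sub_left, Complex.sub_im,
      ContinuousLinearMap.id_apply, hreal, Complex.ofReal_im, sub_zero]
  have hBE : E - B E = χ • G E := by
    rw [hBG]; simp
  have hin : (inner ℂ (E - B E) ((χ * (k : ℂ) ^ 2) • E)).im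
      = ‖χ‖ ^ 2 * k ^ 5 / (16 * Real.pi ^ 2) * sphereIntegral k V E := by
    -- The first slot yields `conj χ`, the second `χ k²`, hence the real factor `|χ|² k²`.
    have h : inner ℂ (E - B E) ((χ * (k : ℂ) ^ 2) • E) =
        ((‖χ‖ ^ 2 * k ^ 2 : ℝ) : ℂ) * inner ℂ (G E) E := by
      rw [hBE, inner_smul_left, inner_smul_right]
      push_cast
      rw [← Complex.conj_mul']
      ring
    rw [h, Complex.im_ofReal_mul, hGim]
    ring
  have hfirst : ‖χ‖ ^ 2 * k ^ 5 / (16 * Real.pi ^ 2) * sphereIntegral k V E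
          = (χ * k ^ 2 * ((∫ r in V, ‖E r‖ ^ 2 : ℝ) : ℂ)).im
            - (χ * k ^ 2 * ∫ r in V, inner ℂ ((B E : L2 V) r) (E r)).im := by
    rw [← hin, ← hreal, ← L2.inner_def, inner_sub_left, inner_smul_right, inner_smul_right,
      Complex.sub_im]
  refine ⟨hfirst, hin, ?_, hGim⟩
  set S := sphereIntegral k V E
  set J := ∫ r in V, inner ℂ ((B E : L2 V) r) (E r)
  set N := ∫ r in V, ‖E r‖ ^ 2
  -- The energy balance is the first identity divided by `k`.
  have e1 : scatteringCrossSection k χ V E = (‖χ‖ ^ 2 * k ^ 5 / (16 * Real.pi ^ 2) * S) / k := by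
    rw [scatteringCrossSection]
    field_simp
    rfl
  have e2 : absorptionCrossSection k χ V E = -(χ * k ^ 2 * (N : ℂ)).im / k := by
    have : -χ * k * (N : ℂ) = ((-1 / k : ℝ) : ℂ) * (χ * k ^ 2 * (N : ℂ)) := by
      have : (k : ℂ) ≠ 0 := by exact_mod_cast hk.ne'
      push_cast
      field_simp
    rw [absorptionCrossSection, this, Complex.im_ofReal_mul]
    ring
  have e3 : -(χ * k ^ 2 / (4 * Real.pi)) * J =
      ((-1 / (4 * Real.pi) : ℝ) : ℂ) * (χ * k ^ 2 * J) := by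
    push_cast
    ring
  rw [e1, e2, e3, Complex.im_ofReal_mul, hfirst]
  field_simp
  ring
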